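/- An $r$-fold graph on $[n]=\{1,\dots,n\}$ consists of $r$ graphs $G_1,\dots,G_r$ (the colours) on the common vertex set $[n]$. The jigsaw process on it starts from the partition of $[n]$ into $n$ single-vertex clusters. In each round, consider the auxiliary graph on the current clusters in which two distinct clusters are adjacent if for every colour $s\in[r]$ there is an edge of $G_s$ between them, and merge all clusters in each connected component of this auxiliary graph; the process stops when the auxiliary graph has no edge or only one cluster remains. The $r$-fold graph percolates if the process ends with one single cluster. For $p_1,\dots,p_r\in[0,1]$ let $\mathbf G(n,p_1,\dots,p_r)$ denote the $r$-fold graph whose colours are independent binomial random graphs $G_i\sim G(n,p_i)$. "Whp" means with probability tending to $1$ as $n\to\infty$. Theorem. Let $r=r(n)$ be integers with $2\le r=o(\sqrt{\ln\ln n})$ and let $C_r:=2^{8r^2}$. For each $n$ let $0\le p_1\le p_2\le\dots\le p_r\le 1$ (depending on $n$), let $P_i:=p_1p_2\cdots p_i$ for $i\in[r]$, and let $\mathbf G=\mathbf G(n,p_1,\dots,p_r)$. (i) If for all sufficiently large $n$ we have $P_i\le\dfrac{1}{C_r\,n(\ln n)^{i-1}}$ for some $2\le i\le r$ (where $i$ may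 depend on $n$) or $P_1\le\dfrac{\ln n}{C_r\,n}$, then whp $\mathbf G$ does not percolate. (ii) If for all sufficiently large $n$ we have $P_i\ge\dfrac{C_r}{n(\ln n)^{i-1}}$ for every $2\le i\le r$ and $P_1\ge\dfrac{C_r\ln n}{n}$, then whp $\mathbf G$ percolates. -/

import Mathlib

open Filter Topology MeasureTheory unitInterval

/-- An `r`-fold graph on the vertex set `V`: one simple graph for each of the `r` colours. -/
abbrev RFoldGraph (r : ℕ) (V : Type*) := Fin r → SimpleGraph V

namespace RFoldGraph

variable {r : ℕ} {V : Type*}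

/-- Given a partition `s` of the vertex set into clusters, the auxiliary graph whose vertices are
the clusters, two distinct clusters being adjacent if there is an edge of every colour between
them (possibly different edges for different colours). -/
def clusterGraph (G : RFoldGraph r V) (s : Setoid V) : SimpleGraph (Quotient s) where
  Adj C D := C ≠ D ∧ ∀ i : Fin r, ∃ u v : V,
    Quotient.mk s u = C ∧ Quotient.mk s v = D ∧ (G i).Adj u v
  symm := ⟨fun _ _ h => ⟨h.1.symm, fun i =>
    let ⟨u, v, hu, hv, huv⟩ := h.2 i
    ⟨v, u, hv, hu, huv.symm⟩⟩⟩
  loopless := ⟨fun _ h => h.1 rfl⟩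

/-- One round of the jigsaw process: the clusters in each connected component of the auxiliary
graph are merged into a single cluster. -/
def jigsawStep (G : RFoldGraph r V) (s : Setoid V) : Setoid V :=
  Setoid.comap (Quotient.mk s) (G.clusterGraph s).reachableSetoid

/-- The partition into clusters after `t` rounds, starting from the discrete partition. Stopping
the process when the auxiliary graph has no edge, or when there is only one cluster, makes no
difference: from then on the partition does not change. -/
def clusters (G : RFoldGraph r V) : ℕ → Setoid V
  | 0 => ⊥
  | t + 1 => G.jigsawStep (G.clusters t)

/-- An `r`-fold graph percolates if the jigsaw process ends with one single cluster. -/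
def Percolates (G : RFoldGraph r V) : Prop :=
  ∃ t : ℕ, Nat.card (Quotient (G.clusters t)) = 1

end RFoldGraph

/-- The law of the `r`-fold binomial random graph on `n` vertices: the graphs of the `r` colours
are independent, the one of colour `i` being distributed as `G(n, p i)`. -/
noncomputable def rFoldBinomial {r : ℕ} (n : ℕ) (p : Fin r → I) :
    Measure (RFoldGraph r (Fin n)) :=
  Measure.pi fun i => SimpleGraph.binomialRandom (Fin n) (p i)

/-- The product `P_i = p_1 ⋯ p_i` of the first `i` edge probabilities. -/
noncomputable def probProd {r : ℕ} (p : Fin r → I) (i : ℕ) : ℝ :=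
  ∏ j ∈ Finset.univ.filter (fun j : Fin r => j.val < i), (p j : ℝ)

/-- The constant `C_r = 2 ^ (8 r²)`. -/
noncomputable def jigsawConst (r : ℕ) : ℝ := 2 ^ (8 * r ^ 2)

namespace RFoldGraph

variable {r : ℕ} {V : Type*}

/-- A partition is closed if no two distinct classes are joined by edges of every colour. -/
def IsClosed (G : RFoldGraph r V) (s : Setoid V) : Prop :=
  ∀ u v, (∀ i, ∃ u' v', s u' u ∧ s v' v ∧ (G i).Adj u' v') → s u v

lemma le_jigsawStep (G : RFoldGraph r V) (s : Setoid V) : s ≤ G.jigsawStep s := by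
  intro u v h
  have : Quotient.mk s u = Quotient.mk s v := Quotient.sound h
  change (G.clusterGraph s).Reachable _ _
  rw [this]

lemma clusters_mono (G : RFoldGraph r V) : Monotone G.clusters :=
  monotone_nat_of_le_succ fun t => G.le_jigsawStep (G.clusters t)

lemma isClosed_of_jigsawStep_eq {G : RFoldGraph r V} {s : Setoid V} (h : G.jigsawStep s = s) :
    G.IsClosed s := by
  intro u v huv
  by_contra hne
  have hadj : (G.clusterGraph s).Adj (Quotient.mk s u) (Quotient.mk s v) := by
    refine ⟨fun h' => hne (Quotient.exact h'), fun i => ?_⟩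
    obtain ⟨u', v', hu, hv, ha⟩ := huv i
    exact ⟨u', v', Quotient.sound hu, Quotient.sound hv, ha⟩
  have : G.jigsawStep s u v := hadj.reachable
  rw [h] at this
  exact hne this

lemma exists_isClosed_clusters [Finite V] (G : RFoldGraph r V) :
    ∃ t, G.IsClosed (G.clusters t) := by
  have : Finite (Setoid V) :=
    Finite.of_injective (fun s : Setoid V => (s : V → V → Prop)) fun a b h =>
      Setoid.ext fun x y => by rw [show a x y = b x y from congrFun (congrFun h x) y]
  obtain ⟨t, ht⟩ := WellFoundedGT.monotone_chain_condition ⟨G.clusters, G.clusters_mono⟩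
  exact ⟨t, isClosed_of_jigsawStep_eq (ht (t + 1) (Nat.le_succ t)).symm⟩

lemma percolates_of_forall_isClosed [Finite V] [Nonempty V] {G : RFoldGraph r V}
    (h : ∀ s, G.IsClosed s → s = ⊤) : G.Percolates := by
  obtain ⟨t, ht⟩ := G.exists_isClosed_clusters
  refine ⟨t, ?_⟩
  rw [h _ ht, Nat.card_eq_one_iff_unique]
  exact ⟨⟨fun a b => Quotient.inductionOn₂ a b fun x y => Quotient.sound trivial⟩,
    ⟨Quotient.mk _ (Classical.arbitrary V)⟩⟩

lemma clusters_le_of_isClosed {G : RFoldGraph r V} {s : Setoid V} (h : G.IsClosed s) (t : ℕ) :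
    G.clusters t ≤ s := by
  induction t with
  | zero => exact bot_le
  | succ t ih =>
    have key : ∀ C D : Quotient (G.clusters t), (G.clusterGraph _).Reachable C D →
        ∀ u v, Quotient.mk _ u = C → Quotient.mk _ v = D → s u v := by
      rintro C D ⟨w⟩
      induction w with
      | nil => intro u v hu hv; exact ih (Quotient.exact (hu.trans hv.symm))
      | @cons C D E hadj w ihw =>
        intro u v hu hv
        obtain ⟨x, rfl⟩ := Quotient.exists_rep D
        refine s.trans (h u x fun i => ?_) (ihw x v rfl hv)
        obtain ⟨a, b, ha, hb, hab⟩ := hadj.2 i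
        exact ⟨a, b, ih (Quotient.exact (ha.trans hu.symm)), ih (Quotient.exact hb), hab⟩
    intro u v huv
    exact key _ _ huv u v rfl rfl

lemma Percolates.eq_top {G : RFoldGraph r V} (hG : G.Percolates) {s : Setoid V}
    (h : G.IsClosed s) : s = ⊤ := by
  obtain ⟨t, ht⟩ := hG
  rw [Nat.card_eq_one_iff_unique] at ht
  have := ht.1
  refine top_le_iff.1 fun u v _ => clusters_le_of_isClosed h t ?_
  exact Quotient.exact (Subsingleton.elim _ _)

/-- A set of vertices inducing a connected graph in every colour. -/
def AllConnected (G : RFoldGraph r V) (U : Finset V) : Prop :=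
  U.Nonempty ∧ ∀ i, ((G i).induce (U : Set V)).Preconnected

lemma AllConnected.union [DecidableEq V] {G : RFoldGraph r V} {U W : Finset V}
    (hU : G.AllConnected U) (hW : G.AllConnected W) (h : ∃ v, v ∈ U ∧ v ∈ W) :
    G.AllConnected (U ∪ W) := by
  refine ⟨hU.1.mono Finset.subset_union_left, fun i => ?_⟩
  rw [Finset.coe_union]
  obtain ⟨v, h1, h2⟩ := h
  exact (SimpleGraph.induce_union_connected (hU.2 i) (hW.2 i) ⟨v, h1, h2⟩).preconnected

lemma AllConnected.union_of_adj [DecidableEq V] {G : RFoldGraph r V} {U W : Finset V}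
    (hU : G.AllConnected U) (hW : G.AllConnected W)
    (h : ∀ i, ∃ u v, u ∈ U ∧ v ∈ W ∧ (G i).Adj u v) :
    G.AllConnected (U ∪ W) := by
  refine ⟨hU.1.mono Finset.subset_union_left, fun i => ?_⟩
  rw [Finset.coe_union]
  obtain ⟨u, v, h1, h2, h3⟩ := h i
  exact (SimpleGraph.connected_induce_union (hU.2 i) (hW.2 i) h1 h2 h3).preconnected

lemma allConnected_singleton (G : RFoldGraph r V) (v : V) : G.AllConnected {v} := by
  refine ⟨⟨v, by simp⟩, fun i => ?_⟩
  rintro ⟨a, ha⟩ ⟨b, hb⟩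
  simp only [Finset.coe_singleton, Set.mem_singleton_iff] at ha hb
  subst ha hb
  exact SimpleGraph.Reachable.refl _

/-- In a percolating `r`-fold graph there are all-connected sets of every size, up to a
factor of two. -/
lemma Percolates.exists_allConnected [Fintype V] {G : RFoldGraph r V} (hG : G.Percolates)
    {k : ℕ} (hk : 1 ≤ k) (hkn : k ≤ Fintype.card V) :
    ∃ U : Finset V, k ≤ U.card ∧ U.card < 2 * k ∧ G.AllConnected U := by
  classical
  by_contra! hno
  rcases hk.eq_or_lt with rfl | hk1
  · obtain ⟨v⟩ : Nonempty V := Fintype.card_pos_iff.1 hkn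
    exact hno {v} (by simp) (by simp) (G.allConnected_singleton v)
  have small : ∀ U, G.AllConnected U → U.card < 2 * k → U.card < k := fun U hU h =>
    not_le.1 fun h' => hno U h' h hU
  let P : V → Finset V → Prop := fun v U => G.AllConnected U ∧ U.card < k ∧ v ∈ U
  have hmerge : ∀ U W, G.AllConnected U → U.card < k → G.AllConnected W → W.card < k →
      G.AllConnected (U ∪ W) → (U ∪ W).card < k := fun U W _ hU _ hW h =>
    small _ h ((Finset.card_union_le _ _).trans_lt (by omega))
  have hmax : ∀ v, ∃ M, P v M ∧ ∀ U, P v U → U ⊆ M := by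
    intro v
    obtain ⟨M, hM, hMm⟩ := Finset.exists_max_image (Finset.univ.filter (P v)) Finset.card
      ⟨{v}, by simpa [P] using ⟨G.allConnected_singleton v, hk1⟩⟩
    have hM' : P v M := by simpa using hM
    refine ⟨M, hM', fun U hU => ?_⟩
    have h1 := hM'.1.union hU.1 ⟨v, hM'.2.2, hU.2.2⟩
    have h2 := hmerge _ _ hM'.1 hM'.2.1 hU.1 hU.2.1 h1
    have h3 := hMm (M ∪ U) (by simpa [P] using ⟨h1, h2, Or.inl hM'.2.2⟩)
    have h4 := Finset.eq_of_subset_of_card_le Finset.subset_union_left h3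
    rw [h4]; exact Finset.subset_union_right
  let s : Setoid V :=
    { r := fun u v => ∃ U, P u U ∧ v ∈ U
      iseqv :=
        { refl := fun v => ⟨{v}, ⟨G.allConnected_singleton v, by simpa using hk1, by simp⟩, by simp⟩
          symm := fun ⟨U, hU, hv⟩ => ⟨U, ⟨hU.1, hU.2.1, hv⟩, hU.2.2⟩
          trans := by
            rintro x y z ⟨U, hU, hy⟩ ⟨W, hW, hz⟩
            have h1 := hU.1.union hW.1 ⟨y, hy, hW.2.2⟩
            exact ⟨U ∪ W, ⟨h1, hmerge _ _ hU.1 hU.2.1 hW.1 hW.2.1 h1,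
              Finset.mem_union_left _ hU.2.2⟩, Finset.mem_union_right _ hz⟩ } }
  have hs : G.IsClosed s := by
    intro u v huv
    obtain ⟨M, hM, hMm⟩ := hmax u
    obtain ⟨N, hN, hNm⟩ := hmax v
    have h1 : G.AllConnected (M ∪ N) := by
      refine hM.1.union_of_adj hN.1 fun i => ?_
      obtain ⟨a, b, ⟨A, hA, hA'⟩, ⟨B, hB, hB'⟩, hab⟩ := huv i
      exact ⟨a, b, hMm A ⟨hA.1, hA.2.1, hA'⟩ hA.2.2, hNm B ⟨hB.1, hB.2.1, hB'⟩ hB.2.2, hab⟩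
    exact ⟨M ∪ N, ⟨h1, hmerge _ _ hM.1 hM.2.1 hN.1 hN.2.1 h1,
      Finset.mem_union_left _ hM.2.2⟩, Finset.mem_union_right _ hN.2.2⟩
  have htop := hG.eq_top hs
  obtain ⟨v⟩ : Nonempty V := Fintype.card_pos_iff.1 (by omega)
  obtain ⟨M, hM, hMm⟩ := hmax v
  have : M = Finset.univ := by
    refine Finset.eq_univ_iff_forall.2 fun w => ?_
    have : s v w := by rw [htop]; trivial
    obtain ⟨U, hU, hw⟩ := this
    exact hMm U hU hw
  have h2 := hM.2.1
  rw [this, Finset.card_univ] at h2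
  omega

lemma Percolates.preconnected [Fintype V] [Nonempty V] {G : RFoldGraph r V} (hG : G.Percolates)
    (i : Fin r) : (G i).Preconnected := by
  obtain ⟨U, h1, -, h3⟩ := hG.exists_allConnected Fintype.card_pos le_rfl
  have hU : U = Finset.univ := by
    rw [← Finset.card_eq_iff_eq_univ]; exact le_antisymm (Finset.card_le_univ _) h1
  subst hU
  intro u v
  exact (h3.2 i ⟨u, by simp⟩ ⟨v, by simp⟩).map (SimpleGraph.Embedding.induce _).toHom

/-- Two sets, each within one class, that see every vertex in all colours but one and each other
in that colour force percolation if that colour is connected. -/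
lemma percolates_of_two_hubs [Finite V] [Nonempty V] {G : RFoldGraph r V} (i₀ : Fin r)
    (hconn : (G i₀).Preconnected) {B₁ B₂ : Finset V} (hB₁ : B₁.Nonempty) (hB₂ : B₂.Nonempty)
    (h₁ : ∀ s, G.IsClosed s → ∀ u ∈ B₁, ∀ v ∈ B₁, s u v)
    (h₂ : ∀ s, G.IsClosed s → ∀ u ∈ B₂, ∀ v ∈ B₂, s u v)
    (hcross : ∃ u ∈ B₁, ∃ v ∈ B₂, (G i₀).Adj u v)
    (hall : (∀ w, (∀ i, i ≠ i₀ → ∃ u ∈ B₁, (G i).Adj u w) ∨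
      (∀ i, i ≠ i₀ → ∃ u ∈ B₂, (G i).Adj u w)))
    (hside : ∀ w ∈ B₂, ∀ i, i ≠ i₀ → ∃ u ∈ B₁, (G i).Adj u w) : G.Percolates := by
  refine percolates_of_forall_isClosed fun s hs => ?_
  obtain ⟨b₁, hb₁⟩ := hB₁
  obtain ⟨b₂, hb₂⟩ := hB₂
  have h12 : s b₁ b₂ := by
    refine hs _ _ fun i => ?_
    by_cases hi : i = i₀
    · subst hi
      obtain ⟨u, hu, v, hv, huv⟩ := hcross
      exact ⟨u, v, h₁ s hs _ hu _ hb₁, h₂ s hs _ hv _ hb₂, huv⟩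
    · obtain ⟨u, hu, huv⟩ := hside b₂ hb₂ i hi
      exact ⟨u, b₂, h₁ s hs _ hu _ hb₁, s.refl _, huv⟩
  have key : ∀ u w, (G i₀).Adj u w → s b₁ u → s b₁ w := by
    intro u w huw hu
    refine hs _ _ fun i => ?_
    by_cases hi : i = i₀
    · subst hi; exact ⟨u, w, s.symm hu, s.refl _, huw⟩
    · rcases hall w with h | h
      · obtain ⟨x, hx, hxw⟩ := h i hi
        exact ⟨x, w, h₁ s hs _ hx _ hb₁, s.refl _, hxw⟩
      · obtain ⟨x, hx, hxw⟩ := h i hi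
        exact ⟨x, w, s.trans (h₂ s hs _ hx _ hb₂) (s.symm h12), s.refl _, hxw⟩
  have hb : ∀ v, s b₁ v := by
    intro v
    obtain ⟨w⟩ := hconn v b₁
    induction w with
    | nil => exact s.refl _
    | cons hadj w ih => exact key _ _ hadj.symm (ih hb₁ h12 (by assumption))
  exact top_le_iff.1 fun u v _ => s.trans (s.symm (hb u)) (hb v)

end RFoldGraph

section Independence

open ProbabilityTheory

lemma iIndepFun_map_iff {ι Ω Ω' : Type*} {β : ι → Type*} [MeasurableSpace Ω] [MeasurableSpace Ω']
    [∀ i, MeasurableSpace (β i)] {μ : Measure Ω} {g : Ω → Ω'} (hg : Measurable g)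
    {X : ∀ i, Ω' → β i} (hX : ∀ i, Measurable (X i)) :
    iIndepFun X (μ.map g) ↔ iIndepFun (fun i ω => X i (g ω)) μ := by
  simp only [iIndepFun_iff_measure_inter_preimage_eq_mul]
  refine forall_congr' fun S => forall_congr' fun s => forall_congr' fun hs => ?_
  rw [Measure.map_apply hg (Finset.measurableSet_biInter _ fun i hi => hX i (hs i hi))]
  have : ∀ i ∈ S, μ.map g (X i ⁻¹' s i) = μ ((fun ω => X i (g ω)) ⁻¹' s i) := fun i hi => by
    rw [Measure.map_apply hg (hX i (hs i hi))]; rfl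
  rw [Finset.prod_congr rfl this]
  simp only [Set.preimage_iInter, Set.preimage_preimage]

end Independence

instance SimpleGraph.instDiscreteMeasurableSpace {V : Type*} [Finite V] :
    DiscreteMeasurableSpace (SimpleGraph V) := by
  refine ⟨fun s => ?_⟩
  rw [← Set.preimage_image_eq s SimpleGraph.edgeSet_injective]
  exact SimpleGraph.measurable_edgeSet (Set.toFinite _).measurableSet

namespace SimpleGraph

open ProbabilityTheory

variable {V : Type*} [Finite V]

lemma measurable_mem_edgeSet (e : Sym2 V) :
    Measurable fun G : SimpleGraph V => e ∈ G.edgeSet := measurable_of_finite _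

lemma iIndepFun_mem_edgeSet (p : I) :
    iIndepFun (fun (e : Sym2 V) (G : SimpleGraph V) => e ∈ G.edgeSet) (binomialRandom V p) := by
  rw [binomialRandom_eq_map, iIndepFun_map_iff measurable_fromEdgeSet measurable_mem_edgeSet,
    setBernoulli_eq_map]
  refine (iIndepFun_map_iff (X := fun (e : Sym2 V) (s : Set (Sym2 V)) => e ∈ (fromEdgeSet s).edgeSet)
    (by exact MeasurableEquiv.setOfPred.measurable) (fun i => measurable_of_finite _)).2 ?_
  have h := iIndepFun_infinitePi (P := fun e : Sym2 V =>
    (toNNReal p • Measure.dirac (e ∈ (Sym2.diagSetᶜ : Set (Sym2 V))) +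
      toNNReal (σ p) • Measure.dirac False)) (X := fun e q => q ∧ ¬ e.IsDiag)
    (fun e => measurable_of_finite _)
  convert h using 4 with e q
  simp [edgeSet_fromEdgeSet]

lemma binomialRandom_mem_edgeSet (p : I) {e : Sym2 V} (he : ¬ e.IsDiag) :
    (binomialRandom V p).real {G | e ∈ G.edgeSet} = p := by
  have h1 : binomialRandom V p {G | e ∈ G.edgeSet} = toNNReal p := by
    rw [binomialRandom_eq_map, Measure.map_apply measurable_fromEdgeSet (Set.toFinite _).measurableSet,
      setBernoulli_apply']
    have : (fun p : Sym2 V → Prop => {i | p i}) ⁻¹' (fromEdgeSet ⁻¹' {G | e ∈ G.edgeSet}) =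
        (fun q : Sym2 V → Prop => q e) ⁻¹' {True} := by
      ext q
      simp [edgeSet_fromEdgeSet, he]
    rw [this, ← Measure.map_apply (measurable_pi_apply e) (Set.toFinite _).measurableSet,
      Measure.infinitePi_map_eval]
    simp [he]
  rw [measureReal_def, h1]
  rfl

end SimpleGraph

namespace RFoldGraph

open ProbabilityTheory

variable {r n : ℕ} {p : Fin r → I}

instance : IsProbabilityMeasure (rFoldBinomial n p) := by
  unfold rFoldBinomial; infer_instance

lemma measurableSet (E : Set (RFoldGraph r (Fin n))) : MeasurableSet E :=
  E.to_countable.measurableSet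

lemma iIndepFun_mem_edgeSet : iIndepFun (fun (x : Fin r × Sym2 (Fin n))
    (G : RFoldGraph r (Fin n)) => x.2 ∈ (G x.1).edgeSet) (rFoldBinomial n p) := by
  refine iIndepFun_uncurry' (X := fun i e (G : RFoldGraph r (Fin n)) => e ∈ (G i).edgeSet)
    (fun i e => measurable_of_countable _) ?_ fun i => ?_
  · exact iIndepFun_pi (X := fun _ (G : SimpleGraph (Fin n)) (e : Sym2 (Fin n)) => e ∈ G.edgeSet)
      (fun i => (measurable_of_countable _).aemeasurable)
  · have h := (measurePreserving_eval
      (fun i => SimpleGraph.binomialRandom (Fin n) (p i)) i).map_eq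
    have h2 := SimpleGraph.iIndepFun_mem_edgeSet (V := Fin n) (p i)
    rw [← h] at h2
    have h3 : Measurable (Function.eval i : RFoldGraph r (Fin n) → SimpleGraph (Fin n)) :=
      measurable_pi_apply i
    exact (iIndepFun_map_iff (μ := rFoldBinomial n p) (β := fun _ : Sym2 (Fin n) => Prop)
      (X := fun (e : Sym2 (Fin n)) (H : SimpleGraph (Fin n)) =>
      e ∈ H.edgeSet) h3 SimpleGraph.measurable_mem_edgeSet).1 h2

/-- The event `E` is determined by the (coloured) edges in `S`. -/
def DependsOnEdges {V : Type*} (E : Set (RFoldGraph r V)) (S : Set (Fin r × Sym2 V)) : Prop :=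
  ∀ G G' : RFoldGraph r V, (∀ x ∈ S, x.2 ∈ (G x.1).edgeSet ↔ x.2 ∈ (G' x.1).edgeSet) →
    G ∈ E → G' ∈ E

lemma DependsOnEdges.compl {V : Type*} {E : Set (RFoldGraph r V)} {S : Set (Fin r × Sym2 V)}
    (h : DependsOnEdges E S) : DependsOnEdges Eᶜ S :=
  fun G G' hG hE hE' => hE (h G' G (fun x hx => (hG x hx).symm) hE')

lemma real_inter_of_dependsOnEdges {E F : Set (RFoldGraph r (Fin n))}
    {S T : Set (Fin r × Sym2 (Fin n))} (hE : DependsOnEdges E S) (hF : DependsOnEdges F T)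
    (hST : Disjoint S T) :
    (rFoldBinomial n p).real (E ∩ F) = (rFoldBinomial n p).real E * (rFoldBinomial n p).real F := by
  classical
  have h := (iIndepFun_mem_edgeSet (n := n) (p := p)).indepFun_finset S.toFinset T.toFinset
    (by simpa using hST) (fun i => measurable_of_countable _)
  rw [indepFun_iff_measure_inter_preimage_eq_mul] at h
  have aux : ∀ (E : Set (RFoldGraph r (Fin n))) (S : Finset (Fin r × Sym2 (Fin n))),
      DependsOnEdges E S → (fun (G : RFoldGraph r (Fin n)) (x : S) => x.1.2 ∈ (G x.1.1).edgeSet) ⁻¹'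
        ((fun (G : RFoldGraph r (Fin n)) (x : S) => x.1.2 ∈ (G x.1.1).edgeSet) '' E) = E := by
    intro E S hE
    refine Set.Subset.antisymm ?_ (Set.subset_preimage_image _ _)
    rintro G' ⟨G, hG, hGG'⟩
    exact hE G G' (fun x hx => iff_of_eq (congrFun hGG' ⟨x, hx⟩)) hG
  have h2 := h _ _ (((fun (G : RFoldGraph r (Fin n)) (x : S.toFinset) =>
    x.1.2 ∈ (G x.1.1).edgeSet) '' E).to_countable.measurableSet)
    (((fun (G : RFoldGraph r (Fin n)) (x : T.toFinset) =>
    x.1.2 ∈ (G x.1.1).edgeSet) '' F).to_countable.measurableSet)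
  rw [aux E _ (by simpa using hE), aux F _ (by simpa using hF)] at h2
  simp only [measureReal_def, h2, ENNReal.toReal_mul]

lemma real_adj (i : Fin r) {u v : Fin n} (huv : u ≠ v) :
    (rFoldBinomial n p).real {G | (G i).Adj u v} = p i := by
  have h := (measurePreserving_eval
      (fun i => SimpleGraph.binomialRandom (Fin n) (p i)) i)
  have h2 := SimpleGraph.binomialRandom_mem_edgeSet (V := Fin n) (p i) (e := s(u, v)) (by simpa)
  rw [measureReal_def, ← h.measure_preimage (Set.to_countable _).measurableSet.nullMeasurableSet] at h2
  exact h2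

lemma real_biInter_of_dependsOnEdges {κ : Type*} (s : Finset κ) {E : κ → Set (RFoldGraph r (Fin n))}
    {S : κ → Set (Fin r × Sym2 (Fin n))} (hE : ∀ k ∈ s, DependsOnEdges (E k) (S k))
    (hS : ∀ k ∈ s, ∀ l ∈ s, k ≠ l → Disjoint (S k) (S l)) :
    (rFoldBinomial n p).real {G | ∀ k ∈ s, G ∈ E k} = ∏ k ∈ s, (rFoldBinomial n p).real (E k) := by
  classical
  induction s using Finset.induction_on with
  | empty => simp
  | insert a s ha ih =>
    have h1 : {G | ∀ k ∈ insert a s, G ∈ E k} = E a ∩ {G | ∀ k ∈ s, G ∈ E k} := by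
      ext G; simp
    have h2 : DependsOnEdges {G | ∀ k ∈ s, G ∈ E k} (⋃ k ∈ s, S k) := by
      intro G G' hG hGE k hk
      exact hE k (Finset.mem_insert_of_mem hk) G G'
        (fun x hx => hG x (Set.mem_biUnion hk hx)) (hGE k hk)
    rw [h1, Finset.prod_insert ha, real_inter_of_dependsOnEdges (hE a (Finset.mem_insert_self _ _)) h2,
      ih (fun k hk => hE k (Finset.mem_insert_of_mem hk))
        (fun k hk l hl => hS k (Finset.mem_insert_of_mem hk) l (Finset.mem_insert_of_mem hl))]
    refine Set.disjoint_iUnion₂_right.2 fun k hk => ?_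
    exact hS a (Finset.mem_insert_self _ _) k (Finset.mem_insert_of_mem hk)
      (fun h => ha (h ▸ hk))

section Conditioning

variable {α : Type*} [Finite α] {f : RFoldGraph r (Fin n) → α} {K : Set α}
  {E : α → Set (RFoldGraph r (Fin n))} {S T : α → Set (Fin r × Sym2 (Fin n))} {c : ℝ}

lemma real_condition_eq_sum (hf : ∀ b ∈ K, DependsOnEdges {G | f G = b} (S b))
    (hE : ∀ b ∈ K, DependsOnEdges (E b) (T b)) (hST : ∀ b ∈ K, Disjoint (S b) (T b)) :
    (rFoldBinomial n p).real {G | f G ∈ K ∧ G ∈ E (f G)} =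
      ∑ b ∈ K.toFinite.toFinset,
        (rFoldBinomial n p).real {G | f G = b} * (rFoldBinomial n p).real (E b) := by
  have h1 : {G | f G ∈ K ∧ G ∈ E (f G)} = ⋃ b ∈ K.toFinite.toFinset, ({G | f G = b} ∩ E b) := by
    ext G
    simp
  rw [h1, measureReal_biUnion_finset _ fun b _ => measurableSet _]
  · refine Finset.sum_congr rfl fun b hb => ?_
    have hb' : b ∈ K := by simpa using hb
    exact real_inter_of_dependsOnEdges (hf b hb') (hE b hb') (hST b hb')
  · intro a _ b _ hab
    refine Set.disjoint_left.2 fun G h2 h3 => hab ?_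
    exact h2.1.symm.trans h3.1

lemma real_mem_eq_sum :
    (rFoldBinomial n p).real {G | f G ∈ K} =
      ∑ b ∈ K.toFinite.toFinset, (rFoldBinomial n p).real {G | f G = b} := by
  have h1 : {G | f G ∈ K} = ⋃ b ∈ K.toFinite.toFinset, {G | f G = b} := by
    ext G
    simp
  rw [h1, measureReal_biUnion_finset _ fun b _ => measurableSet _]
  intro a _ b _ hab
  refine Set.disjoint_left.2 fun G h2 h3 => hab ?_
  exact h2.symm.trans h3

lemma mul_real_le_real_condition (hf : ∀ b ∈ K, DependsOnEdges {G | f G = b} (S b))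
    (hE : ∀ b ∈ K, DependsOnEdges (E b) (T b)) (hST : ∀ b ∈ K, Disjoint (S b) (T b))
    (hc : ∀ b ∈ K, c ≤ (rFoldBinomial n p).real (E b)) :
    c * (rFoldBinomial n p).real {G | f G ∈ K} ≤
      (rFoldBinomial n p).real {G | f G ∈ K ∧ G ∈ E (f G)} := by
  rw [real_condition_eq_sum hf hE hST, real_mem_eq_sum, Finset.mul_sum]
  refine Finset.sum_le_sum fun b hb => ?_
  rw [mul_comm]
  exact mul_le_mul_of_nonneg_left (hc b (by simpa using hb)) measureReal_nonneg

lemma real_condition_le_mul (hf : ∀ b ∈ K, DependsOnEdges {G | f G = b} (S b))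
    (hE : ∀ b ∈ K, DependsOnEdges (E b) (T b)) (hST : ∀ b ∈ K, Disjoint (S b) (T b))
    (hc : ∀ b ∈ K, (rFoldBinomial n p).real (E b) ≤ c) :
    (rFoldBinomial n p).real {G | f G ∈ K ∧ G ∈ E (f G)} ≤
      c * (rFoldBinomial n p).real {G | f G ∈ K} := by
  rw [real_condition_eq_sum hf hE hST, real_mem_eq_sum, Finset.mul_sum]
  refine Finset.sum_le_sum fun b hb => ?_
  rw [mul_comm c]
  exact mul_le_mul_of_nonneg_left (hc b (by simpa using hb)) measureReal_nonneg

end Conditioning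

lemma real_compl (E : Set (RFoldGraph r (Fin n))) :
    (rFoldBinomial n p).real Eᶜ = 1 - (rFoldBinomial n p).real E :=
  probReal_compl_eq_one_sub (measurableSet E)

/-- The coloured pairs with one end in `A` and the other in `B`. -/
def edgesBetween (r : ℕ) {V : Type*} (A B : Finset V) : Set (Fin r × Sym2 V) :=
  {x | ∃ a ∈ A, ∃ b ∈ B, x.2 = s(a, b)}

/-- The coloured pairs with both ends in `W`. -/
def edgesWithin (r : ℕ) {V : Type*} (W : Finset V) : Set (Fin r × Sym2 V) :=
  {x | ∀ v ∈ x.2, v ∈ W}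

lemma disjoint_edgesBetween_edgesWithin {V : Type*} {A B W : Finset V} (h : Disjoint A W) :
    Disjoint (edgesBetween r A B) (edgesWithin r W) := by
  refine Set.disjoint_left.2 ?_
  rintro x ⟨a, ha, b, hb, hx⟩ h2
  exact Finset.disjoint_left.1 h ha (h2 a (by rw [hx]; simp))

lemma disjoint_edgesBetween_edgesWithin' {V : Type*} {A B W : Finset V} (h : Disjoint B W) :
    Disjoint (edgesBetween r A B) (edgesWithin r W) := by
  refine Set.disjoint_left.2 ?_
  rintro x ⟨a, ha, b, hb, hx⟩ h2
  exact Finset.disjoint_left.1 h hb (h2 b (by rw [hx]; simp))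

/-- The `i`-coloured pairs joining `A` to the vertex `w`. -/
def edgesTo {r : ℕ} {V : Type*} (i : Fin r) (A : Finset V) (w : V) : Set (Fin r × Sym2 V) :=
  {x | x.1 = i ∧ ∃ a ∈ A, x.2 = s(a, w)}

lemma dependsOnEdges_exists_adj {V : Type*} (i : Fin r) (A : Finset V) (w : V) :
    DependsOnEdges {G : RFoldGraph r V | ∃ a ∈ A, (G i).Adj a w} (edgesTo i A w) := by
  rintro G G' hG ⟨a, ha, haw⟩
  refine ⟨a, ha, ?_⟩
  simpa using (hG (i, s(a, w)) ⟨rfl, a, ha, rfl⟩).1 (by simpa using haw)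

lemma real_exists_adj (i : Fin r) {A : Finset (Fin n)} {w : Fin n} (hw : w ∉ A) :
    (rFoldBinomial n p).real {G | ∃ a ∈ A, (G i).Adj a w} = 1 - (1 - (p i : ℝ)) ^ A.card := by
  have h1 : {G : RFoldGraph r (Fin n) | ∃ a ∈ A, (G i).Adj a w} =
      {G | ∀ a ∈ A, G ∈ {G : RFoldGraph r (Fin n) | (G i).Adj a w}ᶜ}ᶜ := by
    ext G; simp
  rw [h1, real_compl, real_biInter_of_dependsOnEdges A (S := fun a => {(i, s(a, w))})]
  · congr 1
    rw [Finset.prod_congr rfl (g := fun _ => 1 - (p i : ℝ)), Finset.prod_const]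
    intro a ha
    rw [real_compl, real_adj]
    rintro rfl; exact hw ha
  · intro a ha
    refine DependsOnEdges.compl fun G G' hG hG' => ?_
    simpa using (hG _ rfl).1 (by simpa using hG')
  · intro a ha b hb hab
    simp only [Set.disjoint_singleton, ne_eq, Prod.mk.injEq, true_and, Sym2.eq_iff, not_or, not_and]
    grind

open Classical in
/-- The vertices of `R` that have neighbours of every colour in `A`. -/
noncomputable def attached {V : Type*} (G : RFoldGraph r V) (A R : Finset V) : Finset V :=
  R.filter fun w => ∀ i, ∃ a ∈ A, (G i).Adj a w

lemma attached_subset {V : Type*} (G : RFoldGraph r V) (A R : Finset V) : G.attached A R ⊆ R := by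
  classical
  exact Finset.filter_subset _ _

lemma mem_attached {V : Type*} {G : RFoldGraph r V} {A R : Finset V} {w : V} :
    w ∈ G.attached A R ↔ w ∈ R ∧ ∀ i, ∃ a ∈ A, (G i).Adj a w := by
  classical
  simp [attached]

lemma attached_congr {V : Type*} {G G' : RFoldGraph r V} {A R : Finset V}
    (h : ∀ x ∈ edgesBetween r A R, x.2 ∈ (G x.1).edgeSet ↔ x.2 ∈ (G' x.1).edgeSet) :
    G.attached A R = G'.attached A R := by
  ext w
  simp only [mem_attached]
  refine and_congr_right fun hw => forall_congr' fun i => exists_congr fun a =>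
    and_congr_right fun ha => ?_
  exact h (i, s(a, w)) ⟨a, ha, w, hw, rfl⟩

lemma dependsOnEdges_attached {V : Type*} (A R : Finset V) (P : Finset V → Prop) :
    DependsOnEdges {G : RFoldGraph r V | P (G.attached A R)} (edgesBetween r A R) := by
  intro G G' hG h
  change P _
  rw [← attached_congr hG]
  exact h

/-- The probability that a vertex has neighbours of every colour in a given set of `x` others. -/
noncomputable def attachProb (p : Fin r → I) (x : ℕ) : ℝ := ∏ i, (1 - (1 - (p i : ℝ)) ^ x)

lemma attachProb_nonneg (x : ℕ) : 0 ≤ attachProb p x :=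
  Finset.prod_nonneg fun i _ => sub_nonneg.2 (pow_le_one₀ (sub_nonneg.2 (p i).2.2)
    (sub_le_self _ (p i).2.1))

lemma attachProb_le_one (x : ℕ) : attachProb p x ≤ 1 :=
  Finset.prod_le_one (fun i _ => sub_nonneg.2 (pow_le_one₀ (sub_nonneg.2 (p i).2.2)
    (sub_le_self _ (p i).2.1))) fun _ _ => sub_le_self _ (pow_nonneg (sub_nonneg.2 (p _).2.2) _)

lemma dependsOnEdges_forall_exists_adj {V : Type*} (A : Finset V) (w : V) :
    DependsOnEdges {G : RFoldGraph r V | ∀ i, ∃ a ∈ A, (G i).Adj a w} (edgesBetween r A {w}) := by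
  intro G G' hG h i
  exact dependsOnEdges_exists_adj i A w G G'
    (fun x hx => hG x (by obtain ⟨-, a, ha, hx⟩ := hx; exact ⟨a, ha, w, by simp, hx⟩)) (h i)

lemma real_forall_exists_adj {A : Finset (Fin n)} {w : Fin n} (hw : w ∉ A) :
    (rFoldBinomial n p).real {G | ∀ i, ∃ a ∈ A, (G i).Adj a w} = attachProb p A.card := by
  have h1 : {G : RFoldGraph r (Fin n) | ∀ i, ∃ a ∈ A, (G i).Adj a w} =
      {G | ∀ i ∈ Finset.univ, G ∈ {G : RFoldGraph r (Fin n) | ∃ a ∈ A, (G i).Adj a w}} := by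
    ext G; simp
  rw [h1, real_biInter_of_dependsOnEdges _ (fun i _ => dependsOnEdges_exists_adj i A w)]
  · exact Finset.prod_congr rfl fun i _ => real_exists_adj i hw
  · intro i _ j _ hij
    refine Set.disjoint_left.2 fun x hx hx' => hij (hx.1.symm.trans hx'.1)

lemma disjoint_edgesBetween_right {V : Type*} {A R R' : Finset V} (hR : Disjoint R R')
    (hA : Disjoint A R) :
    Disjoint (edgesBetween r A R) (edgesBetween r A R') := by
  refine Set.disjoint_left.2 ?_
  rintro x ⟨a, ha, b, hb, hx⟩ ⟨a', ha', b', hb', hx'⟩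
  rw [hx, Sym2.eq_iff] at hx'
  rw [Finset.disjoint_left] at hR hA
  rcases hx' with ⟨rfl, rfl⟩ | ⟨rfl, rfl⟩
  · exact hR hb hb'
  · exact hA ha' hb

lemma real_attached_eq_empty {A R : Finset (Fin n)} (h : Disjoint A R) :
    (rFoldBinomial n p).real {G | G.attached A R = ∅} = (1 - attachProb p A.card) ^ R.card := by
  have h1 : {G : RFoldGraph r (Fin n) | G.attached A R = ∅} =
      {G | ∀ w ∈ R, G ∈ {G : RFoldGraph r (Fin n) | ∀ i, ∃ a ∈ A, (G i).Adj a w}ᶜ} := by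
    ext G
    simp [Finset.eq_empty_iff_forall_notMem, mem_attached]
  rw [h1, real_biInter_of_dependsOnEdges _
    (fun w _ => (dependsOnEdges_forall_exists_adj A w).compl)]
  · rw [Finset.prod_congr rfl (g := fun _ => 1 - attachProb p A.card), Finset.prod_const]
    intro w hw
    rw [real_compl, real_forall_exists_adj (Finset.disjoint_right.1 h hw)]
  · intro v hv w hw hvw
    refine disjoint_edgesBetween_right (by simpa using hvw) ?_
    simpa using Finset.disjoint_right.1 h hv

lemma attached_union {V : Type*} [DecidableEq V] (G : RFoldGraph r V) (A R R' : Finset V) :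
    G.attached A (R ∪ R') = G.attached A R ∪ G.attached A R' := by
  ext w; simp only [mem_attached, Finset.mem_union]; tauto

/-- Lower bound, useful when few vertices are expected to be attached. -/
lemma pow_le_real_le_card_attached {A : Finset (Fin n)} {g : ℕ} (y : ℕ) {R : Finset (Fin n)}
    (h : Disjoint A R) (hR : y * g ≤ R.card) :
    (1 - (1 - attachProb p A.card) ^ g) ^ y ≤
      (rFoldBinomial n p).real {G | y ≤ (G.attached A R).card} := by
  induction y generalizing R with
  | zero => simp
  | succ y ih =>
    obtain ⟨R₁, hR₁, hg⟩ := Finset.exists_subset_card_eq (s := R) (n := g) (by linarith [Nat.zero_le (y * g)])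
    have h2 := ih (R := R \ R₁) (h.mono_right Finset.sdiff_subset)
      (by rw [Finset.card_sdiff_of_subset hR₁, hg]; rw [add_mul, one_mul] at hR; omega)
    have h3 : (rFoldBinomial n p).real {G : RFoldGraph r (Fin n) | G.attached A R₁ = ∅}ᶜ =
        1 - (1 - attachProb p A.card) ^ g := by
      rw [real_compl, real_attached_eq_empty (h.mono_right hR₁), hg]
    have hd : Disjoint (edgesBetween r A R₁) (edgesBetween r A (R \ R₁)) :=
      disjoint_edgesBetween_right Finset.disjoint_sdiff (h.mono_right hR₁)
    have h4 := real_inter_of_dependsOnEdges (p := p)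
      (dependsOnEdges_attached A R₁ (fun X => X = ∅)).compl
      (dependsOnEdges_attached A (R \ R₁) (fun X => y ≤ X.card)) hd
    rw [pow_succ']
    refine le_trans (mul_le_mul_of_nonneg_left h2 ?_) (le_trans (b := _) (le_of_eq ?_)
      (measureReal_mono (s₁ := {G | G.attached A R₁ = ∅}ᶜ ∩ {G | y ≤ (G.attached A (R \ R₁)).card}) ?_))
    · rw [← h3]; exact measureReal_nonneg
    · rw [h4, ← h3]
    · rintro G ⟨h5, h6⟩
      change y + 1 ≤ _
      have h7 : R = R₁ ∪ (R \ R₁) := (Finset.union_sdiff_of_subset hR₁).symm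
      rw [h7, attached_union, Finset.card_union_of_disjoint]
      · have : 0 < (G.attached A R₁).card := Finset.card_pos.2 (Finset.nonempty_iff_ne_empty.2 h5)
        simp only [Set.mem_ofPred_eq] at h6
        omega
      · exact Finset.disjoint_of_subset_left (attached_subset _ _ _)
          (Finset.disjoint_of_subset_right (attached_subset _ _ _) Finset.disjoint_sdiff)

/-- Upper bound for the lower tail, useful when many vertices are expected to be attached. -/
lemma real_card_attached_lt_le {A : Finset (Fin n)} (y : ℕ) {R : Finset (Fin n)}
    (h : Disjoint A R) :
    (rFoldBinomial n p).real {G | (G.attached A R).card < y} ≤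
      2 ^ y * (1 - attachProb p A.card / 2) ^ R.card := by
  have ha0 := attachProb_nonneg (p := p) A.card
  have ha1 := attachProb_le_one (p := p) A.card
  induction R using Finset.induction_on generalizing y with
  | empty =>
    rcases Nat.eq_zero_or_pos y with rfl | hy
    · simp
    · simpa using le_trans measureReal_le_one (one_le_pow₀ (by norm_num : (1 : ℝ) ≤ 2))
  | insert w R hw ih =>
    rw [Finset.disjoint_insert_right] at h
    rcases Nat.eq_zero_or_pos y with rfl | hy
    · simp only [not_lt_zero, Set.ofPred_false, measureReal_empty]
      have : 0 ≤ 1 - attachProb p A.card / 2 := by linarith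
      positivity
    obtain ⟨z, rfl⟩ : ∃ z, y = z + 1 := ⟨y - 1, by omega⟩
    set F : Set (RFoldGraph r (Fin n)) := {G | ∀ i, ∃ a ∈ A, (G i).Adj a w} with hF
    classical
    have hcard : ∀ G : RFoldGraph r (Fin n), (G.attached A (insert w R)).card =
        (G.attached A R).card + (if G ∈ F then 1 else 0) := by
      intro G
      have : G.attached A (insert w R) = if G ∈ F then insert w (G.attached A R)
          else G.attached A R := by
        ext v
        by_cases hG : G ∈ F
        · rw [if_pos hG]
          simp only [mem_attached, Finset.mem_insert]
          constructor
          · rintro ⟨rfl | h1, h2⟩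
            · exact Or.inl rfl
            · exact Or.inr ⟨h1, h2⟩
          · rintro (rfl | h1)
            · exact ⟨Or.inl rfl, hG⟩
            · exact ⟨Or.inr h1.1, h1.2⟩
        · rw [if_neg hG]
          simp only [mem_attached, Finset.mem_insert]
          constructor
          · rintro ⟨rfl | h1, h2⟩
            · exact absurd h2 hG
            · exact ⟨h1, h2⟩
          · rintro h1
            exact ⟨Or.inr h1.1, h1.2⟩
      rw [this]
      split_ifs
      · rw [Finset.card_insert_of_notMem (fun h' => hw (attached_subset _ _ _ h'))]
      · rfl
    have hsplit : {G : RFoldGraph r (Fin n) | (G.attached A (insert w R)).card < z + 1} ⊆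
        (F ∩ {G | (G.attached A R).card < z}) ∪ (Fᶜ ∩ {G | (G.attached A R).card < z + 1}) := by
      intro G hG
      simp only [Set.mem_ofPred_eq, hcard] at hG
      by_cases hGF : G ∈ F
      · rw [if_pos hGF] at hG
        exact Or.inl ⟨hGF, by simpa using hG⟩
      · rw [if_neg hGF] at hG
        exact Or.inr ⟨hGF, by simpa using hG⟩
    have hd : Disjoint (edgesBetween r A {w}) (edgesBetween r A R) :=
      disjoint_edgesBetween_right (by simpa using hw) (by simpa using h.1)
    have h1 : (rFoldBinomial n p).real (F ∩ {G | (G.attached A R).card < z}) ≤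
        attachProb p A.card * (2 ^ z * (1 - attachProb p A.card / 2) ^ R.card) := by
      rw [real_inter_of_dependsOnEdges (dependsOnEdges_forall_exists_adj A w)
        (dependsOnEdges_attached A R (fun X => X.card < z)) hd, real_forall_exists_adj h.1]
      exact mul_le_mul_of_nonneg_left (ih z h.2) ha0
    have h2 : (rFoldBinomial n p).real (Fᶜ ∩ {G | (G.attached A R).card < z + 1}) ≤
        (1 - attachProb p A.card) * (2 ^ (z + 1) * (1 - attachProb p A.card / 2) ^ R.card) := by
      rw [real_inter_of_dependsOnEdges (dependsOnEdges_forall_exists_adj A w).compl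
        (dependsOnEdges_attached A R (fun X => X.card < z + 1)) hd, real_compl,
        real_forall_exists_adj h.1]
      exact mul_le_mul_of_nonneg_left (ih (z + 1) h.2) (by linarith)
    calc _ ≤ _ := measureReal_mono hsplit
      _ ≤ _ := measureReal_union_le _ _
      _ ≤ _ := add_le_add h1 h2
      _ = _ := by rw [Finset.card_insert_of_notMem hw]; ring

/-- A subset of `E` with `y` elements, if there is one. -/
noncomputable def pick {V : Type*} (y : ℕ) (E : Finset V) : Finset V :=
  if h : y ≤ E.card then (Finset.exists_subset_card_eq h).choose else ∅

lemma pick_subset {V : Type*} {y : ℕ} {E : Finset V} (h : y ≤ E.card) : pick y E ⊆ E := by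
  rw [pick, dif_pos h]; exact (Finset.exists_subset_card_eq h).choose_spec.1

lemma card_pick {V : Type*} {y : ℕ} {E : Finset V} (h : y ≤ E.card) : (pick y E).card = y := by
  rw [pick, dif_pos h]; exact (Finset.exists_subset_card_eq h).choose_spec.2

/-- Growing a cluster through the layers `R 0, R 1, …`: after `j` steps we have a set of `x j`
vertices of layer `R (j - 1)`, each of them attached to the previous set, or we have failed. -/
noncomputable def run (G : RFoldGraph r (Fin n)) (R : ℕ → Finset (Fin n)) (x : ℕ → ℕ)
    (A : Finset (Fin n)) : ℕ → Option (Finset (Fin n))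
  | 0 => some A
  | j + 1 => (G.run R x A j).bind fun B =>
      if x (j + 1) ≤ (G.attached B (R j)).card then some (pick (x (j + 1)) (G.attached B (R j)))
      else none

/-- All vertices which have been part of the sets grown in the first `j` steps. -/
noncomputable def used (G : RFoldGraph r (Fin n)) (R : ℕ → Finset (Fin n)) (x : ℕ → ℕ)
    (A : Finset (Fin n)) : ℕ → Finset (Fin n)
  | 0 => A
  | j + 1 => G.used R x A j ∪ (G.run R x A (j + 1)).getD ∅

/-- The starting set together with the first `j` layers. -/
def territory (R : ℕ → Finset (Fin n)) (A : Finset (Fin n)) (j : ℕ) : Finset (Fin n) :=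
  A ∪ (Finset.range j).biUnion R

section Run

variable {G G' : RFoldGraph r (Fin n)} {R : ℕ → Finset (Fin n)} {x : ℕ → ℕ}
  {A B W : Finset (Fin n)} {j m : ℕ}

lemma territory_mono (h : j ≤ m) : territory R A j ⊆ territory R A m :=
  Finset.union_subset_union_right (Finset.biUnion_subset_biUnion_of_subset_left _
    (Finset.range_subset_range.2 h))

lemma layer_subset_territory : R j ⊆ territory R A (j + 1) := fun v hv =>
  Finset.mem_union_right _ (Finset.mem_biUnion.2 ⟨j, by simp, hv⟩)

lemma run_succ_eq_some (h : G.run R x A (j + 1) = some B) :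
    ∃ C, G.run R x A j = some C ∧ x (j + 1) ≤ (G.attached C (R j)).card ∧
      B = pick (x (j + 1)) (G.attached C (R j)) := by
  rw [run, Option.bind_eq_some_iff] at h
  obtain ⟨C, hC, h⟩ := h
  split_ifs at h with h1
  exact ⟨C, hC, h1, (Option.some.inj h).symm⟩

lemma card_of_run_eq_some (hA : A.card = x 0) (h : G.run R x A j = some B) : B.card = x j := by
  cases j with
  | zero => rw [run, Option.some.injEq] at h; rw [← h, hA]
  | succ j =>
    obtain ⟨C, -, h1, rfl⟩ := run_succ_eq_some h
    exact card_pick h1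

lemma subset_layer_of_run_eq_some (h : G.run R x A (j + 1) = some B) : B ⊆ R j := by
  obtain ⟨C, -, h1, rfl⟩ := run_succ_eq_some h
  exact (pick_subset h1).trans (attached_subset _ _ _)

lemma subset_territory_of_run_eq_some (h : G.run R x A j = some B) : B ⊆ territory R A j := by
  cases j with
  | zero =>
    rw [run, Option.some.injEq] at h
    rw [← h]; exact Finset.subset_union_left
  | succ j => exact (subset_layer_of_run_eq_some h).trans layer_subset_territory

lemma run_eq_some_class {s : Setoid (Fin n)} (hs : G.IsClosed s) {a : Fin n}
    (hA : ∀ u ∈ A, s a u) (h : G.run R x A j = some B) : ∀ v ∈ B, s a v := by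
  induction j generalizing B with
  | zero => rw [run, Option.some.injEq] at h; rwa [← h]
  | succ j ih =>
    obtain ⟨C, hC, h1, rfl⟩ := run_succ_eq_some h
    intro v hv
    refine hs a v fun i => ?_
    obtain ⟨c, hc, hcv⟩ := (mem_attached.1 (pick_subset h1 hv)).2 i
    exact ⟨c, v, s.symm (ih hC c hc), s.refl _, hcv⟩

lemma used_subset_territory : G.used R x A j ⊆ territory R A j := by
  induction j with
  | zero => exact Finset.subset_union_left
  | succ j ih =>
    refine Finset.union_subset (ih.trans (territory_mono (Nat.le_succ j))) ?_
    cases h : G.run R x A (j + 1) with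
    | none => exact Finset.empty_subset _
    | some B => exact subset_territory_of_run_eq_some h

lemma card_used_le (hA : A.card = x 0) : (G.used R x A j).card ≤ ∑ k ∈ Finset.range (j + 1), x k := by
  induction j with
  | zero => simp [used, hA]
  | succ j ih =>
    rw [Finset.sum_range_succ]
    refine (Finset.card_union_le _ _).trans (add_le_add ih ?_)
    cases h : G.run R x A (j + 1) with
    | none => simp
    | some B => exact (card_of_run_eq_some hA h).le

lemma subset_used_of_run_eq_some (h : G.run R x A j = some B) : B ⊆ G.used R x A j := by
  cases j with
  | zero => rw [run, Option.some.injEq] at h; rw [← h]; exact subset_rfl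
  | succ j => rw [used, h]; exact Finset.subset_union_right

lemma run_congr_of_within
    (h : ∀ e ∈ edgesWithin r W, e.2 ∈ (G e.1).edgeSet ↔ e.2 ∈ (G' e.1).edgeSet)
    (hW : territory R A m ⊆ W) (hj : j ≤ m) : G.run R x A j = G'.run R x A j := by
  induction j with
  | zero => rfl
  | succ j ih =>
    rw [run, run, ← ih (by omega)]
    refine Option.bind_congr fun B hB => ?_
    have hB' : B ⊆ W := ((subset_territory_of_run_eq_some hB).trans
      (territory_mono (by omega))).trans hW
    have hR : R j ⊆ W := (layer_subset_territory.trans (territory_mono hj)).trans hW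
    rw [attached_congr (G := G) (G' := G')]
    rintro e ⟨a, ha, b, hb, he⟩
    refine h e fun v hv => ?_
    rw [he, Sym2.mem_iff] at hv
    rcases hv with rfl | rfl
    exacts [hB' ha, hR hb]

lemma used_congr (h : ∀ k ≤ j, G.run R x A k = G'.run R x A k) :
    G.used R x A j = G'.used R x A j := by
  induction j with
  | zero => rfl
  | succ j ih => rw [used, used, ih fun k hk => h k (by omega), h (j + 1) le_rfl]

lemma run_congr_of_not_within
    (h : ∀ e ∈ (edgesWithin r W)ᶜ, e.2 ∈ (G e.1).edgeSet ↔ e.2 ∈ (G' e.1).edgeSet)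
    (hW : Disjoint (G.used R x A j) W) : G.run R x A j = G'.run R x A j := by
  induction j with
  | zero => rfl
  | succ j ih =>
    have h1 : Disjoint (G.used R x A j) W := hW.mono_left Finset.subset_union_left
    rw [run, run, ← ih h1]
    refine Option.bind_congr fun B hB => ?_
    have hB' : Disjoint B W := h1.mono_left (subset_used_of_run_eq_some hB)
    rw [attached_congr (G := G) (G' := G')]
    intro e he
    exact h e (Set.disjoint_left.1 (disjoint_edgesBetween_edgesWithin hB') he)

lemma run_congr_of_not_within_le
    (h : ∀ e ∈ (edgesWithin r W)ᶜ, e.2 ∈ (G e.1).edgeSet ↔ e.2 ∈ (G' e.1).edgeSet)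
    (hW : Disjoint (G.used R x A m) W) (hj : j ≤ m) : G.run R x A j = G'.run R x A j := by
  refine run_congr_of_not_within h (hW.mono_left ?_)
  exact monotone_nat_of_le_succ (f := G.used R x A) (fun k => Finset.subset_union_left) hj

lemma dependsOnEdges_run_eq (b : Option (Finset (Fin n))) :
    DependsOnEdges {G : RFoldGraph r (Fin n) | G.run R x A m = b}
      (edgesWithin r (territory R A m)) := by
  intro G G' h hG
  change _ = _
  rw [← run_congr_of_within h subset_rfl le_rfl]
  exact hG

lemma prod_le_real_run {q : ℕ → ℝ} (hq : ∀ j < m, 0 ≤ q j) (hA : A.card = x 0)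
    (hAR : ∀ j < m, Disjoint A (R j)) (hR : ∀ j < m, ∀ k < j, Disjoint (R k) (R j))
    (h : ∀ j < m, ∀ B : Finset (Fin n), B.card = x j → Disjoint B (R j) →
      q j ≤ (rFoldBinomial n p).real {G | x (j + 1) ≤ (G.attached B (R j)).card}) :
    ∏ j ∈ Finset.range m, q j ≤ (rFoldBinomial n p).real {G | G.run R x A m ≠ none} := by
  induction m with
  | zero => simp [run]
  | succ m ih =>
    have ih' := ih (fun j hj => hq j (by omega)) (fun j hj => hAR j (by omega))
      (fun j hj => hR j (by omega)) (fun j hj => h j (by omega))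
    have hdisj : Disjoint (R m) (territory R A m) := by
      rw [territory, Finset.disjoint_union_right, Finset.disjoint_biUnion_right]
      exact ⟨(hAR m (by omega)).symm, fun k hk => (hR m (by omega) k (by simpa using hk)).symm⟩
    let K : Set (Option (Finset (Fin n))) :=
      {b | ∃ B, b = some B ∧ B.card = x m ∧ B ⊆ territory R A m}
    have key := mul_real_le_real_condition (p := p) (f := fun G : RFoldGraph r (Fin n) => G.run R x A m)
      (K := K) (E := fun b => {G | x (m + 1) ≤ (G.attached (b.getD ∅) (R m)).card})
      (T := fun b => edgesBetween r (b.getD ∅) (R m)) (c := q m)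
      (fun b _ => dependsOnEdges_run_eq b)
      (fun b _ => dependsOnEdges_attached _ _ fun X => x (m + 1) ≤ X.card)
      (fun b _ => (disjoint_edgesBetween_edgesWithin' hdisj).symm) (by
        rintro b ⟨B, rfl, hB, hBt⟩
        exact h m (by omega) B hB (Finset.disjoint_of_subset_left hBt hdisj.symm))
    rw [Finset.prod_range_succ, mul_comm]
    refine (mul_le_mul_of_nonneg_left ih' (hq m (by omega))).trans (le_trans (le_of_eq ?_)
      (key.trans (measureReal_mono ?_)))
    · congr 2
      ext G
      constructor
      · intro hG
        obtain ⟨B, hB⟩ := Option.ne_none_iff_exists'.1 hG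
        exact ⟨B, hB, card_of_run_eq_some hA hB, subset_territory_of_run_eq_some hB⟩
      · rintro ⟨B, hB, -⟩ h'
        simp [hB] at h'
    · rintro G ⟨⟨B, hB, -⟩, hG⟩
      simp only [Set.mem_ofPred_eq, hB, Option.getD_some] at hG
      simp [run, hB, hG]

end Run

/-- Growing clusters from one seed after the other, until one of them has survived `m` steps. -/
noncomputable def trials (G : RFoldGraph r (Fin n)) (x : ℕ → ℕ) (m : ℕ) :
    List (Fin n) → (ℕ → Finset (Fin n)) → Option (Finset (Fin n))
  | [], _ => none
  | v :: vs, R => (G.run R x {v} m).or (G.trials x m vs fun j => R j \ G.used R x {v} m)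

section Trials

variable {G G' : RFoldGraph r (Fin n)} {R : ℕ → Finset (Fin n)} {x : ℕ → ℕ} {vs : List (Fin n)}
  {B W : Finset (Fin n)} {m : ℕ}

lemma territory_sdiff_subset {A U : Finset (Fin n)} :
    territory (fun j => R j \ U) A m ⊆ territory R A m :=
  Finset.union_subset_union_right (Finset.biUnion_mono fun _ _ => Finset.sdiff_subset)

lemma card_of_trials_eq_some (hx : x 0 = 1) (h : G.trials x m vs R = some B) : B.card = x m := by
  induction vs generalizing R with
  | nil => simp [trials] at h
  | cons v vs ih =>
    rw [trials, Option.or_eq_some_iff] at h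
    rcases h with h | ⟨-, h⟩
    · exact card_of_run_eq_some (by simp [hx]) h
    · exact ih h

lemma trials_eq_some_class {s : Setoid (Fin n)} (hs : G.IsClosed s)
    (h : G.trials x m vs R = some B) : ∃ a, ∀ v ∈ B, s a v := by
  induction vs generalizing R with
  | nil => simp [trials] at h
  | cons v vs ih =>
    rw [trials, Option.or_eq_some_iff] at h
    rcases h with h | ⟨-, h⟩
    · exact ⟨v, run_eq_some_class hs (by simp) h⟩
    · exact ih h

lemma subset_territory_of_trials_eq_some (h : G.trials x m vs R = some B) :
    B ⊆ territory R vs.toFinset m := by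
  induction vs generalizing R with
  | nil => simp [trials] at h
  | cons v vs ih =>
    rw [trials, Option.or_eq_some_iff] at h
    rcases h with h | ⟨-, h⟩
    · refine (subset_territory_of_run_eq_some h).trans (Finset.union_subset_union_left ?_)
      simp
    · refine ((ih h).trans territory_sdiff_subset).trans (Finset.union_subset_union_left ?_)
      simp [Finset.subset_insert]

lemma trials_congr_of_within
    (h : ∀ e ∈ edgesWithin r W, e.2 ∈ (G e.1).edgeSet ↔ e.2 ∈ (G' e.1).edgeSet)
    (hW : territory R vs.toFinset m ⊆ W) : G.trials x m vs R = G'.trials x m vs R := by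
  induction vs generalizing R with
  | nil => rfl
  | cons v vs ih =>
    have h1 : territory R {v} m ⊆ W := by
      refine (Finset.union_subset_union_left ?_).trans hW
      simp
    have h2 : ∀ k ≤ m, G.run R x {v} k = G'.run R x {v} k := fun k hk =>
      run_congr_of_within h h1 hk
    rw [trials, trials, h2 m le_rfl, used_congr h2, ih]
    refine territory_sdiff_subset.trans ((Finset.union_subset_union_left ?_).trans hW)
    simp [Finset.subset_insert]

lemma real_trials_eq_none_le {q : ℕ → ℝ} {ρ : ℕ → ℕ} {Y : ℕ} (hx : x 0 = 1)
    (hY : ∑ k ∈ Finset.range (m + 1), x k ≤ Y) (hq0 : ∀ j < m, 0 ≤ q j) (hq1 : ∀ j < m, q j ≤ 1)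
    (h : ∀ j < m, ∀ B R' : Finset (Fin n), B.card = x j → Disjoint B R' → ρ j ≤ R'.card →
      q j ≤ (rFoldBinomial n p).real {G | x (j + 1) ≤ (G.attached B R').card})
    (hvs : vs.Nodup) (hvR : ∀ v ∈ vs, ∀ j < m, v ∉ R j)
    (hR : ∀ j < m, ∀ k < j, Disjoint (R k) (R j))
    (hρ : ∀ j < m, ρ j + vs.length * Y ≤ (R j).card) :
    (rFoldBinomial n p).real {G | G.trials x m vs R = none} ≤
      (1 - ∏ j ∈ Finset.range m, q j) ^ vs.length := by
  have hq : 0 ≤ 1 - ∏ j ∈ Finset.range m, q j := by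
    have := Finset.prod_le_one (s := Finset.range m) (f := q) (fun j hj => hq0 j (by simpa using hj))
      (fun j hj => hq1 j (by simpa using hj))
    linarith
  induction vs generalizing R with
  | nil => simp [trials]
  | cons v vs ih =>
    rw [List.nodup_cons] at hvs
    let W : Finset (Fin n) → Finset (Fin n) := fun U => territory (fun j => R j \ U) vs.toFinset m
    let K : Set (Option (Finset (Fin n)) × Finset (Fin n)) :=
      {b | b.1 = none ∧ b.2 ⊆ territory R {v} m ∧ b.2.card ≤ Y}
    have hfail : (rFoldBinomial n p).real {G | G.run R x {v} m = none} ≤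
        1 - ∏ j ∈ Finset.range m, q j := by
      have h1 := prod_le_real_run (p := p) (R := R) (A := {v}) hq0 (by simp [hx])
        (fun j hj => by simpa using hvR v (by simp) j hj) hR
        (fun j hj B hB hBR => h j hj B (R j) hB hBR (by linarith [hρ j hj, Nat.zero_le ((v :: vs).length * Y)]))
      have h2 := real_compl (p := p) {G | G.run R x {v} m ≠ none}
      have h3 : {G : RFoldGraph r (Fin n) | G.run R x {v} m ≠ none}ᶜ =
        {G | G.run R x {v} m = none} := by ext G; simp
      rw [h3] at h2
      linarith
    have key := real_condition_le_mul (p := p)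
      (f := fun G : RFoldGraph r (Fin n) => (G.run R x {v} m, G.used R x {v} m))
      (K := K) (E := fun b => {G | G.trials x m vs (fun j => R j \ b.2) = none})
      (S := fun b => (edgesWithin r (W b.2))ᶜ) (T := fun b => edgesWithin r (W b.2))
      (c := (1 - ∏ j ∈ Finset.range m, q j) ^ vs.length) ?_ ?_ ?_ ?_
    · calc _ ≤ _ := measureReal_mono (fun G hG => ?_)
        _ ≤ _ := key
        _ ≤ (1 - ∏ j ∈ Finset.range m, q j) ^ vs.length *
            (rFoldBinomial n p).real {G | G.run R x {v} m = none} :=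
          mul_le_mul_of_nonneg_left (measureReal_mono fun G hG => hG.1) (pow_nonneg hq _)
        _ ≤ _ := by
          rw [List.length_cons, pow_succ]
          exact mul_le_mul_of_nonneg_left hfail (pow_nonneg hq _)
      simp only [trials, Set.mem_ofPred_eq, Option.or_eq_none_iff] at hG
      exact ⟨⟨hG.1, used_subset_territory, (card_used_le (by simp [hx])).trans hY⟩, hG.2⟩
    · rintro ⟨b, U⟩ ⟨-, hb, -⟩ G G' hGG' hG
      simp only [Set.mem_ofPred_eq, Prod.mk.injEq] at hG hb ⊢
      have hd : Disjoint (G.used R x {v} m) (W U) := by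
        rw [hG.2]
        simp only [W, territory, Finset.disjoint_union_right, Finset.disjoint_biUnion_right]
        refine ⟨?_, fun j _ => Finset.disjoint_sdiff⟩
        refine Finset.disjoint_of_subset_left hb (Finset.disjoint_right.2 fun w hw hw' => ?_)
        rw [List.mem_toFinset] at hw
        rw [territory, Finset.mem_union, Finset.mem_singleton, Finset.mem_biUnion] at hw'
        rcases hw' with rfl | ⟨j, hj, hwj⟩
        · exact hvs.1 hw
        · exact hvR w (List.mem_cons_of_mem _ hw) j (by simpa using hj) hwj
      have h2 : ∀ k ≤ m, G.run R x {v} k = G'.run R x {v} k := fun k hk =>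
        run_congr_of_not_within_le hGG' hd hk
      rw [← h2 m le_rfl, ← used_congr h2]
      exact hG
    · rintro ⟨b, U⟩ - G G' hGG' hG
      simp only [Set.mem_ofPred_eq] at hG ⊢
      rw [← trials_congr_of_within hGG' subset_rfl]
      exact hG
    · intro b _
      exact disjoint_compl_left
    · rintro ⟨b, U⟩ ⟨-, -, hU⟩
      simp only at hU
      refine ih hvs.2 (fun w hw j hj hwj => hvR w (List.mem_cons_of_mem _ hw) j hj
        (Finset.sdiff_subset hwj)) (fun j hj k hk => (hR j hj k hk).mono Finset.sdiff_subset
        Finset.sdiff_subset) fun j hj => ?_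
      have h1 := hρ j hj
      have h2 := Finset.le_card_sdiff U (R j)
      rw [List.length_cons, add_mul, one_mul] at h1
      simp only
      omega

end Trials

lemma half_min_le_one_sub_pow {t : ℝ} (h0 : 0 ≤ t) (h1 : t ≤ 1) (x : ℕ) :
    min 1 (x * t) / 2 ≤ 1 - (1 - t) ^ x := by
  have h2 : (1 - t) ^ x ≤ Real.exp (-(x * t)) := by
    calc (1 - t) ^ x ≤ Real.exp (-t) ^ x :=
          pow_le_pow_left₀ (by linarith) (by linarith [Real.add_one_le_exp (-t)]) _
      _ = _ := by rw [← Real.exp_nat_mul]; ring_nf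
  have hu : 0 ≤ x * t := by positivity
  set u := x * t
  have h3 : Real.exp (-u) * (1 + u) ≤ 1 := by
    calc Real.exp (-u) * (1 + u) ≤ Real.exp (-u) * Real.exp u :=
          mul_le_mul_of_nonneg_left (by linarith [Real.add_one_le_exp u]) (Real.exp_pos _).le
      _ = 1 := by rw [← Real.exp_add]; simp
  rcases le_total u 1 with h | h
  · rw [min_eq_right h]
    have : Real.exp (-u) ≤ 1 - u / 2 := by
      have : Real.exp (-u) * (1 + u) ≤ (1 - u / 2) * (1 + u) := by nlinarith
      exact le_of_mul_le_mul_right this (by linarith)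
    linarith
  · rw [min_eq_left h]
    nlinarith

lemma one_sub_pow_le_exp {t : ℝ} (h1 : t ≤ 1) (x : ℕ) : (1 - t) ^ x ≤ Real.exp (-(x * t)) := by
  calc (1 - t) ^ x ≤ Real.exp (-t) ^ x :=
        pow_le_pow_left₀ (by linarith) (by linarith [Real.add_one_le_exp (-t)]) _
    _ = _ := by rw [← Real.exp_nat_mul]; ring_nf

lemma exists_le_attachProb (hp : Monotone p) (x : ℕ) :
    ∃ k ≤ r, (x : ℝ) ^ k * probProd p k / 2 ^ r ≤ attachProb p x := by
  classical
  have hex : ∃ k, ∀ i : Fin r, k ≤ i.val → 1 ≤ x * (p i : ℝ) := ⟨r, fun i hi => by omega⟩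
  set k := Nat.find hex with hk
  have hkr : k ≤ r := Nat.find_min' hex fun i hi => by omega
  have hbig : ∀ i : Fin r, k ≤ i.val → 1 ≤ x * (p i : ℝ) := Nat.find_spec hex
  have hsmall : ∀ i : Fin r, i.val < k → x * (p i : ℝ) ≤ 1 := by
    intro i hi
    have := Nat.find_min hex (m := k - 1) (by omega)
    push Not at this
    obtain ⟨j, hj, hj1⟩ := this
    have : (p i : ℝ) ≤ p j := hp (Fin.le_def.2 (by omega))
    exact le_trans (mul_le_mul_of_nonneg_left this (Nat.cast_nonneg _)) hj1.le
  refine ⟨k, hkr, ?_⟩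
  have hcard : (Finset.univ.filter fun j : Fin r => j.val < k).card = k := by
    rw [Fin.card_filter_val_lt]; omega
  calc (x : ℝ) ^ k * probProd p k / 2 ^ r
      = ∏ i : Fin r, (if i.val < k then x * (p i : ℝ) else 1) / 2 := by
        rw [Finset.prod_div_distrib, Finset.prod_const, Finset.card_univ, Fintype.card_fin,
          ← Finset.prod_filter, Finset.prod_mul_distrib, Finset.prod_const, hcard, probProd]
    _ ≤ attachProb p x := by
        refine Finset.prod_le_prod (fun i _ => ?_) fun i _ => ?_
        · have := (p i).2.1
          split_ifs <;> positivity
        · refine le_trans ?_ (half_min_le_one_sub_pow (p i).2.1 (p i).2.2 x)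
          split_ifs with h
          · rw [min_eq_right (hsmall i h)]
          · rw [min_eq_left (hbig i (not_lt.1 h))]

/-- The assumptions on `n`, `r` and the edge probabilities under which percolation is likely. -/
structure Supercritical (n : ℕ) (p : Fin r → I) : Prop where
  two_le : 2 ≤ r
  mono : Monotone p
  const_le : jigsawConst r ≤ Real.log n
  one : jigsawConst r * Real.log n / n ≤ probProd p 1
  ge_two : ∀ i : ℕ, 2 ≤ i → i ≤ r → jigsawConst r / (n * Real.log n ^ (i - 1)) ≤ probProd p i

lemma jigsawConst_pos (r : ℕ) : 0 < jigsawConst r := by unfold jigsawConst; positivity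

lemma two_pow_le_jigsawConst {k : ℕ} (h : k ≤ 8 * r ^ 2) : (2 : ℝ) ^ k ≤ jigsawConst r :=
  pow_le_pow_right₀ (by norm_num) h

namespace Supercritical

variable (h : Supercritical n p)
include h

lemma log_ge : (2 : ℝ) ^ 32 ≤ Real.log n :=
  (two_pow_le_jigsawConst (by nlinarith [h.two_le])).trans h.const_le

lemma n_pos : 0 < (n : ℝ) := by
  rcases Nat.eq_zero_or_pos n with h0 | h0
  · have := h.log_ge
    rw [h0] at this; norm_num at this
  · exact_mod_cast h0

lemma log_pow_le_sqrt : Real.log n ^ 10 ≤ √n := by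
  have hL := h.log_ge
  set L := Real.log n with hLdef
  have h1 : √(n : ℝ) = Real.exp (L / 20) ^ 10 := by
    rw [← Real.exp_nat_mul, Real.sqrt_eq_iff_mul_self_eq (by positivity) (by positivity),
      ← Real.exp_add]
    rw [show (((10 : ℕ) : ℝ) * (L / 20) + ((10 : ℕ) : ℝ) * (L / 20)) = L by push_cast; ring,
      Real.exp_log h.n_pos]
  rw [h1]
  have hL0 : 0 ≤ L := le_trans (by norm_num) hL
  refine pow_le_pow_left₀ hL0 ?_ _
  have h2 := Real.quadratic_le_exp_of_nonneg (x := L / 20) (by positivity)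
  nlinarith

/-- The three regimes for the probability that a vertex is attached to a set of size `x`. -/
lemma attachProb_cases (x : ℕ) :
    1 / 2 ^ r ≤ attachProb p x ∨
    x * (jigsawConst r * Real.log n / n) / 2 ^ r ≤ attachProb p x ∨
    ∃ k, 2 ≤ k ∧ k ≤ r ∧
      (x : ℝ) ^ k * (jigsawConst r / (n * Real.log n ^ (k - 1))) / 2 ^ r ≤ attachProb p x := by
  obtain ⟨k, hkr, hk⟩ := exists_le_attachProb h.mono x
  rcases Nat.lt_or_ge k 2 with h2 | h2
  · interval_cases k
    · left
      simpa [probProd] using hk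
    · right; left
      refine le_trans ?_ hk
      rw [pow_one]
      gcongr
      exact h.one
  · right; right
    refine ⟨k, h2, hkr, le_trans ?_ hk⟩
    gcongr
    exact h.ge_two k h2 hkr

/-- A set of size `2 ^ j`, up to the critical size, has a fair chance to see a vertex in a set
of about `n / 2 ^ J` vertices. -/
lemma small_growth {J j g : ℕ} (hj : j < J) (hJ : (2 : ℝ) ^ J * (2 ^ r) ^ 4 ≤ Real.log n)
    (hJ' : Real.log n ≤ 2 * 2 ^ J * (2 ^ r) ^ 4) (hg : (n : ℝ) / 2 ^ (J + 6) ≤ g) :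
    (1 / 2 : ℝ) ^ ((r + 1) * (J - j) + 1) ≤ 1 - (1 - attachProb p (2 ^ j)) ^ g := by
  refine le_trans ?_ (half_min_le_one_sub_pow (attachProb_nonneg _) (attachProb_le_one _) g)
  rw [pow_succ, ← div_eq_mul_one_div]
  gcongr
  refine le_min (pow_le_one₀ (by norm_num) (by norm_num)) ?_
  have hn := h.n_pos
  have hL := h.log_ge
  set L := Real.log n
  have hsq := h.log_pow_le_sqrt
  have hnL : L ^ 2 ≤ n := by
    calc L ^ 2 ≤ L ^ 20 := pow_le_pow_right₀ (le_trans (by norm_num) hL) (by norm_num)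
      _ = (L ^ 10) ^ 2 := by ring
      _ ≤ √n ^ 2 := pow_le_pow_left₀ (by positivity) hsq _
      _ = n := Real.sq_sqrt hn.le
  obtain ⟨d, rfl⟩ : ∃ d, J = j + d := ⟨J - j, by omega⟩
  rw [Nat.add_sub_cancel_left]
  have hr := h.two_le
  set M : ℝ := 2 ^ r with hM
  have hM1 : 1 ≤ M := one_le_pow₀ (by norm_num)
  set X : ℝ := 2 ^ j with hX
  have hX1 : 1 ≤ X := one_le_pow₀ (by norm_num)
  set D : ℝ := 2 ^ d with hD
  have hD1 : 1 ≤ D := one_le_pow₀ (by norm_num)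
  have hK : (2 : ℝ) ^ (j + d) = X * D := pow_add _ _ _
  rw [hK] at hJ hJ'
  have hg' : (n : ℝ) / (64 * (X * D)) ≤ g := by
    refine le_trans (le_of_eq ?_) hg
    rw [pow_add, hK]; norm_num; ring
  have hdd : (1 / 2 : ℝ) ^ ((r + 1) * d) = 1 / D ^ (r + 1) := by
    rw [one_div_pow, hD, ← pow_mul, mul_comm d]
  rw [hdd]
  have hC1 : 1 ≤ jigsawConst r := one_le_pow₀ (by norm_num)
  have hC128 : 64 * M ≤ jigsawConst r := by
    rw [show (64 : ℝ) * M = 2 ^ (6 + r) by rw [hM, pow_add]; norm_num]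
    exact two_pow_le_jigsawConst (by nlinarith)
  have hDr : D ≤ D ^ (r + 1) := le_self_pow₀ hD1 (by omega)
  have hXM : X * D * M ≤ L := by
    refine le_trans ?_ hJ
    gcongr
    exact le_self_pow₀ hM1 (by norm_num)
  have cast_pow : ((2 ^ j : ℕ) : ℝ) = X := by push_cast; rfl
  rcases h.attachProb_cases (2 ^ j) with hc | hc | ⟨k, hk2, hkr, hc⟩
  · calc 1 / D ^ (r + 1) ≤ 1 := by
          rw [div_le_one (by positivity)]; exact one_le_pow₀ hD1
      _ ≤ (n / (64 * (X * D))) * (1 / M) := by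
          rw [div_mul_div_comm, le_div_iff₀ (by positivity)]
          nlinarith
      _ ≤ g * attachProb p (2 ^ j) := by gcongr
  · rw [cast_pow] at hc
    calc 1 / D ^ (r + 1) ≤ 1 / D := by gcongr
      _ ≤ (n / (64 * (X * D))) * (X * (jigsawConst r * L / n) / M) := by
          rw [show ((n : ℝ) / (64 * (X * D))) * (X * (jigsawConst r * L / n) / M) =
            (jigsawConst r * L) / (64 * M) / D by field_simp]
          gcongr
          rw [le_div_iff₀ (by positivity)]
          have : 1 ≤ L := le_trans (by norm_num) hL
          nlinarith
      _ ≤ g * attachProb p (2 ^ j) := by gcongr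
  · rw [cast_pow] at hc
    have hC : 64 * M * (2 * M ^ 4) ^ (k - 1) ≤ jigsawConst r := by
      calc 64 * M * (2 * M ^ 4) ^ (k - 1) ≤ 64 * M * (2 * M ^ 4) ^ (r - 1) := by
            gcongr
            · have := one_le_pow₀ hM1 (n := 4); linarith
        _ = 2 ^ (6 + r + (4 * r + 1) * (r - 1)) := by
            rw [pow_add, pow_add, pow_mul, pow_add, hM]; ring
        _ ≤ _ := by
            refine two_pow_le_jigsawConst ?_
            obtain ⟨s, rfl⟩ : ∃ s, r = s + 2 := ⟨r - 2, by omega⟩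
            simp only [Nat.add_succ_sub_one]
            nlinarith
    obtain ⟨l, rfl⟩ : ∃ l, k = l + 1 := ⟨k - 1, by omega⟩
    rw [Nat.add_sub_cancel] at hC hc
    calc 1 / D ^ (r + 1) ≤ 1 / D ^ (l + 1) := by gcongr; omega
      _ ≤ (64 * M * (2 * M ^ 4) ^ l) * (1 / (64 * M * (2 * M ^ 4) ^ l)) * (1 / D ^ (l + 1)) := by
          rw [mul_one_div_cancel (by positivity), one_mul]
      _ ≤ jigsawConst r * (1 / (64 * M * (2 * M ^ 4) ^ l)) * (1 / D ^ (l + 1)) := by gcongr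
      _ = (n / (64 * (X * D))) * (X ^ (l + 1) * (jigsawConst r / (n * (2 * (X * D) * M ^ 4) ^ l)) / M) := by
          have : (2 * (X * D) * M ^ 4) ^ l = (2 * M ^ 4) ^ l * X ^ l * D ^ l := by
            rw [← mul_pow, ← mul_pow]; ring_nf
          rw [this, pow_succ X, pow_succ D]
          field_simp
      _ ≤ (n / (64 * (X * D))) * (X ^ (l + 1) * (jigsawConst r / (n * L ^ l)) / M) := by gcongr
      _ ≤ g * attachProb p (2 ^ j) := by gcongr

/-- Beyond the critical size, a set of size `2 ^ (J + i)` is expected to see many vertices in a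
layer. -/
lemma large_growth {J i ρ : ℕ} (hJ' : Real.log n ≤ 2 * 2 ^ J * (2 ^ r) ^ 4)
    (hi : (2 : ℝ) ^ (J + i) ≤ n / (512 * Real.log n * 2 ^ r))
    (hρ : (n : ℝ) / 2 ^ (i + 6) ≤ ρ) (hρ' : (n : ℝ) / (64 * Real.log n) ≤ ρ) :
    8 * (2 : ℝ) ^ (J + i) ≤ ρ * attachProb p (2 ^ (J + i)) := by
  have hn := h.n_pos
  have hL := h.log_ge
  set L := Real.log n
  have hr := h.two_le
  set M : ℝ := 2 ^ r with hM
  have hM1 : 1 ≤ M := one_le_pow₀ (by norm_num)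
  set K : ℝ := 2 ^ J with hK
  have hK1 : 1 ≤ K := one_le_pow₀ (by norm_num)
  set Z : ℝ := 2 ^ i with hZ
  have hZ1 : 1 ≤ Z := one_le_pow₀ (by norm_num)
  have hKZ : (2 : ℝ) ^ (J + i) = K * Z := pow_add _ _ _
  have cast_pow : ((2 ^ (J + i) : ℕ) : ℝ) = K * Z := by push_cast; exact hKZ
  have hρ'' : (n : ℝ) / (64 * Z) ≤ ρ := by
    refine le_trans (le_of_eq ?_) hρ
    rw [pow_add]; norm_num; ring
  rw [hKZ] at hi ⊢
  have hC0 : 0 < jigsawConst r := jigsawConst_pos r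
  rcases h.attachProb_cases (2 ^ (J + i)) with hc | hc | ⟨k, hk2, hkr, hc⟩
  · calc 8 * (K * Z) ≤ 8 * (n / (512 * L * M)) := by gcongr
      _ = (n / (64 * L)) * (1 / M) := by field_simp; norm_num
      _ ≤ ρ * attachProb p (2 ^ (J + i)) := by gcongr
  · rw [cast_pow] at hc
    have hC : 512 * M ≤ jigsawConst r := by
      rw [show (512 : ℝ) * M = 2 ^ (9 + r) by rw [hM, pow_add]; norm_num]
      exact two_pow_le_jigsawConst (by nlinarith)
    calc 8 * (K * Z) ≤ (jigsawConst r / (64 * M)) * (K * Z) := by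
          gcongr
          rw [le_div_iff₀ (by positivity)]; linarith
      _ = (n / (64 * L)) * (K * Z * (jigsawConst r * L / n) / M) := by field_simp
      _ ≤ ρ * attachProb p (2 ^ (J + i)) := by gcongr
  · rw [cast_pow] at hc
    have hC : 8 * (64 * M * (2 * M ^ 4) ^ (k - 1)) ≤ jigsawConst r := by
      calc 8 * (64 * M * (2 * M ^ 4) ^ (k - 1)) ≤ 8 * (64 * M * (2 * M ^ 4) ^ (r - 1)) := by
            gcongr
            · have := one_le_pow₀ hM1 (n := 4); linarith
        _ = 2 ^ (9 + r + (4 * r + 1) * (r - 1)) := by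
            rw [pow_add, pow_add, pow_mul, pow_add, hM]; ring
        _ ≤ _ := by
            refine two_pow_le_jigsawConst ?_
            obtain ⟨s, rfl⟩ : ∃ s, r = s + 2 := ⟨r - 2, by omega⟩
            simp only [Nat.add_succ_sub_one]
            nlinarith
    obtain ⟨l, rfl⟩ : ∃ l, k = l + 1 := ⟨k - 1, by omega⟩
    rw [Nat.add_sub_cancel] at hC hc
    have hl : Z ≤ Z ^ l := le_self_pow₀ hZ1 (by omega)
    calc 8 * (K * Z) ≤ (jigsawConst r / (64 * M * (2 * M ^ 4) ^ l)) * (K * Z) := by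
          gcongr
          rw [le_div_iff₀ (by positivity)]; linarith
      _ ≤ (jigsawConst r / (64 * M * (2 * M ^ 4) ^ l)) * (K * Z ^ l) := by
          gcongr
      _ = (n / (64 * Z)) * ((K * Z) ^ (l + 1) * (jigsawConst r / (n * (2 * K * M ^ 4) ^ l)) / M) := by
          have : (2 * K * M ^ 4) ^ l = (2 * M ^ 4) ^ l * K ^ l := by
            rw [← mul_pow]; ring_nf
          rw [this, mul_pow K Z, pow_succ K, pow_succ Z]
          field_simp
      _ ≤ (n / (64 * Z)) * ((K * Z) ^ (l + 1) * (jigsawConst r / (n * L ^ l)) / M) := by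
          gcongr
      _ ≤ ρ * attachProb p (2 ^ (J + i)) := by gcongr

end Supercritical

lemma run_congr_of_touching {G G' : RFoldGraph r (Fin n)} {R : ℕ → Finset (Fin n)} {x : ℕ → ℕ}
    {A : Finset (Fin n)} {m : ℕ}
    (h : ∀ e : Fin r × Sym2 (Fin n), (∃ v ∈ e.2, v ∈ (Finset.range m).biUnion R) →
      (e.2 ∈ (G e.1).edgeSet ↔ e.2 ∈ (G' e.1).edgeSet)) :
    G.run R x A m = G'.run R x A m := by
  induction m with
  | zero => rfl
  | succ m ih =>
    have hsub : (Finset.range m).biUnion R ⊆ (Finset.range (m + 1)).biUnion R :=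
      Finset.biUnion_subset_biUnion_of_subset_left _ (Finset.range_subset_range.2 (Nat.le_succ m))
    rw [run, run, ← ih fun e ⟨v, hv, hv'⟩ => h e ⟨v, hv, hsub hv'⟩]
    refine Option.bind_congr fun B _ => ?_
    rw [attached_congr (G := G) (G' := G')]
    rintro e ⟨a, -, b, hb, he⟩
    exact h e ⟨b, by simp [he], Finset.mem_biUnion.2 ⟨m, by simp, hb⟩⟩

/-- First find a seed that survives `m₁` steps, then continue from there for `m₂` steps. -/
lemma real_trials_bind_run_eq_none_le {x₁ x₂ : ℕ → ℕ} {m₁ m₂ : ℕ} {vs : List (Fin n)}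
    {R₁ R₂ : ℕ → Finset (Fin n)} {q₂ : ℕ → ℝ} {ε : ℝ} (hx₁ : x₁ 0 = 1) (hx : x₁ m₁ = x₂ 0)
    (hε : (rFoldBinomial n p).real {G | G.trials x₁ m₁ vs R₁ = none} ≤ ε)
    (hq : ∀ j < m₂, 0 ≤ q₂ j) (hq1 : ∀ j < m₂, q₂ j ≤ 1)
    (hdisj : ∀ j < m₂, Disjoint (territory R₁ vs.toFinset m₁) (R₂ j))
    (hR : ∀ j < m₂, ∀ k < j, Disjoint (R₂ k) (R₂ j))
    (h : ∀ j < m₂, ∀ B : Finset (Fin n), B.card = x₂ j → Disjoint B (R₂ j) →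
      q₂ j ≤ (rFoldBinomial n p).real {G | x₂ (j + 1) ≤ (G.attached B (R₂ j)).card}) :
    (rFoldBinomial n p).real
      {G | (G.trials x₁ m₁ vs R₁).bind (fun A => G.run R₂ x₂ A m₂) = none} ≤
        ε + (1 - ∏ j ∈ Finset.range m₂, q₂ j) := by
  let K : Set (Option (Finset (Fin n))) :=
    {b | ∃ A, b = some A ∧ A.card = x₂ 0 ∧ A ⊆ territory R₁ vs.toFinset m₁}
  have hq' : 0 ≤ 1 - ∏ j ∈ Finset.range m₂, q₂ j := by
    have := Finset.prod_le_one (s := Finset.range m₂) (f := q₂)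
      (fun j hj => hq j (by simpa using hj)) (fun j hj => hq1 j (by simpa using hj))
    linarith
  have key := real_condition_le_mul (p := p)
    (f := fun G : RFoldGraph r (Fin n) => G.trials x₁ m₁ vs R₁) (K := K)
    (E := fun b => {G | G.run R₂ x₂ (b.getD ∅) m₂ = none})
    (S := fun _ => edgesWithin r (territory R₁ vs.toFinset m₁))
    (T := fun _ => {e | ∃ v ∈ e.2, v ∈ (Finset.range m₂).biUnion R₂})
    (c := 1 - ∏ j ∈ Finset.range m₂, q₂ j) ?_ ?_ ?_ ?_
  · calc _ ≤ _ := measureReal_mono (s₂ := {G | G.trials x₁ m₁ vs R₁ = none} ∪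
        {G | G.trials x₁ m₁ vs R₁ ∈ K ∧
          G.run R₂ x₂ ((G.trials x₁ m₁ vs R₁).getD ∅) m₂ = none}) ?_
      _ ≤ _ := measureReal_union_le _ _
      _ ≤ _ := add_le_add hε (key.trans (mul_le_of_le_one_right hq' measureReal_le_one))
    intro G hG
    simp only [Set.mem_ofPred_eq] at hG
    cases hA : G.trials x₁ m₁ vs R₁ with
    | none => exact Or.inl hA
    | some A =>
      refine Or.inr ⟨⟨A, hA, ?_, subset_territory_of_trials_eq_some hA⟩, ?_⟩
      · rw [card_of_trials_eq_some hx₁ hA, hx]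
      · rw [hA] at hG ⊢
        simpa using hG
  · intro b _ G G' hGG' hG
    simp only [Set.mem_ofPred_eq] at hG ⊢
    rw [← trials_congr_of_within hGG' subset_rfl]
    exact hG
  · intro b _ G G' hGG' hG
    simp only [Set.mem_ofPred_eq] at hG ⊢
    rw [← run_congr_of_touching hGG']
    exact hG
  · intro b _
    refine Set.disjoint_left.2 fun e he ⟨v, hv, hv'⟩ => ?_
    obtain ⟨j, hj, hvj⟩ := Finset.mem_biUnion.1 hv'
    exact Finset.disjoint_left.1 (hdisj j (by simpa using hj)) (he v hv) hvj
  · rintro b ⟨A, rfl, hA, hAt⟩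
    have h1 := prod_le_real_run (p := p) hq hA
      (fun j hj => Finset.disjoint_of_subset_left hAt (hdisj j hj)) hR h
    have h2 := real_compl (p := p) {G | G.run R₂ x₂ A m₂ ≠ none}
    have h3 : {G : RFoldGraph r (Fin n) | G.run R₂ x₂ A m₂ ≠ none}ᶜ =
      {G | G.run R₂ x₂ A m₂ = none} := by ext G; simp
    rw [h3] at h2
    simp only [Option.getD_some]
    linarith

lemma exists_layers {V : Type*} [DecidableEq V] (W : Finset V) (s : ℕ → ℕ) (m : ℕ)
    (h : ∑ j ∈ Finset.range m, s j ≤ W.card) :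
    ∃ R : ℕ → Finset V, (∀ j < m, (R j).card = s j ∧ R j ⊆ W) ∧
      ∀ j < m, ∀ k < j, Disjoint (R k) (R j) := by
  induction m generalizing W with
  | zero => exact ⟨fun _ => ∅, by simp, by simp⟩
  | succ m ih =>
    rw [Finset.sum_range_succ] at h
    obtain ⟨U, hU, hUc⟩ := Finset.exists_subset_card_eq (s := W) (n := s m) (by omega)
    obtain ⟨R, hR, hRd⟩ := ih (W \ U) (by rw [Finset.card_sdiff_of_subset hU]; omega)
    have hd : ∀ j < m, Disjoint (R j) U := fun j hj =>
      Finset.disjoint_of_subset_left (hR j hj).2 Finset.sdiff_disjoint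
    refine ⟨fun j => if j = m then U else R j, fun j hj => ?_, fun j hj k hk => ?_⟩
    · by_cases hjm : j = m
      · simp [hjm, hU, hUc]
      · simp only [hjm, if_false]
        exact ⟨(hR j (by omega)).1, (hR j (by omega)).2.trans Finset.sdiff_subset⟩
    · have hkm : k ≠ m := by omega
      by_cases hjm : j = m
      · simp only [hjm, hkm, if_false, if_true]
        exact hd k (by omega)
      · simp only [hjm, hkm, if_false]
        exact hRd j (by omega) k hk

lemma sum_small_exponents_le (r J : ℕ) :
    ∑ j ∈ Finset.range J, ((r + 1) * (J - j) + 1) * 2 ^ (j + 1) ≤ (2 * r + 3) * 2 ^ (J + 1) := by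
  induction J with
  | zero => simp
  | succ J ih =>
    have h1 : ∀ j ∈ Finset.range J, ((r + 1) * (J + 1 - j) + 1) * 2 ^ (j + 1) =
        ((r + 1) * (J - j) + 1) * 2 ^ (j + 1) + (r + 1) * (2 * 2 ^ j) := by
      intro j hj
      rw [Finset.mem_range] at hj
      rw [show J + 1 - j = (J - j) + 1 by omega]
      ring
    have h2 : ∑ j ∈ Finset.range J, 2 ^ j ≤ 2 ^ J := by
      have := Nat.geomSum_eq (m := 2) le_rfl J
      rw [this]; simp
    rw [Finset.sum_range_succ, Finset.sum_congr rfl h1, Finset.sum_add_distrib, ← Finset.mul_sum,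
      ← Finset.mul_sum, Nat.add_sub_cancel_left]
    calc _ ≤ (2 * r + 3) * 2 ^ (J + 1) + (r + 1) * (2 * 2 ^ J) + ((r + 1) * 1 + 1) * 2 ^ (J + 1) := by
          gcongr
      _ = (2 * r + 3) * 2 ^ (J + 1 + 1) := by ring

lemma one_sub_sum_le_prod {q : ℕ → ℝ} {m : ℕ} (h0 : ∀ j < m, 0 ≤ q j) (h1 : ∀ j < m, q j ≤ 1) :
    1 - ∑ j ∈ Finset.range m, q j ≤ ∏ j ∈ Finset.range m, (1 - q j) := by
  induction m with
  | zero => simp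
  | succ m ih =>
    have ih' := ih (fun j hj => h0 j (by omega)) (fun j hj => h1 j (by omega))
    rw [Finset.sum_range_succ, Finset.prod_range_succ]
    have h2 := h0 m (by omega)
    have h3 := h1 m (by omega)
    have h4 : 0 ≤ ∑ j ∈ Finset.range m, q j :=
      Finset.sum_nonneg fun j hj => h0 j (by have := Finset.mem_range.1 hj; omega)
    nlinarith

namespace Supercritical

variable (h : Supercritical n p)
include h

lemma exp_neg_le_prod {J : ℕ} (hJ : (2 : ℝ) ^ J * (2 ^ r) ^ 4 ≤ Real.log n) :
    Real.exp (-(Real.log n / 4)) ≤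
      ∏ j ∈ Finset.range J, ((1 / 2 : ℝ) ^ ((r + 1) * (J - j) + 1)) ^ (2 ^ (j + 1)) := by
  simp only [← pow_mul]
  rw [Finset.prod_pow_eq_pow_sum]
  have h1 : (1 / 2 : ℝ) ^ ((2 * r + 3) * 2 ^ (J + 1)) ≤
      (1 / 2 : ℝ) ^ (∑ j ∈ Finset.range J, ((r + 1) * (J - j) + 1) * 2 ^ (j + 1)) :=
    pow_le_pow_of_le_one (by norm_num) (by norm_num) (sum_small_exponents_le r J)
  refine le_trans ?_ h1
  have h2 : Real.exp (-1) ≤ 1 / 2 := by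
    rw [Real.exp_neg, one_div]
    gcongr
    linarith [Real.add_one_le_exp 1]
  refine le_trans ?_ (pow_le_pow_left₀ (Real.exp_pos _).le h2 _)
  rw [← Real.exp_nat_mul]
  gcongr
  push_cast
  have hr : 8 * (2 * (r : ℝ) + 3) ≤ (2 ^ r) ^ 4 := by
    have : ∀ s : ℕ, 8 * (2 * (s + 2) + 3) ≤ (2 ^ (s + 2)) ^ 4 := by
      intro s
      induction s with
      | zero => norm_num
      | succ s ih =>
        calc 8 * (2 * (s + 1 + 2) + 3) ≤ 16 * (8 * (2 * (s + 2) + 3)) := by omega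
          _ ≤ 16 * (2 ^ (s + 2)) ^ 4 := by gcongr
          _ = _ := by ring
    obtain ⟨s, rfl⟩ : ∃ s, r = s + 2 := ⟨r - 2, by have := h.two_le; omega⟩
    exact_mod_cast this s
  have h3 : (2 * (r : ℝ) + 3) * 2 ^ (J + 1) * 4 ≤ Real.log n := by
    calc (2 * (r : ℝ) + 3) * 2 ^ (J + 1) * 4 = 2 ^ J * (8 * (2 * (r : ℝ) + 3)) := by ring
      _ ≤ 2 ^ J * (2 ^ r) ^ 4 := by gcongr
      _ ≤ _ := hJ
  linarith

lemma exists_critical_exponent : ∃ J : ℕ, (2 : ℝ) ^ J * (2 ^ r) ^ 4 ≤ Real.log n ∧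
    Real.log n ≤ 2 * 2 ^ J * (2 ^ r) ^ 4 ∧ 1 / 2 ^ J ≤ 1 / √(Real.log n) := by
  have hL := h.log_ge
  have hr := h.two_le
  set L := Real.log n
  have hL0 : 0 < L := lt_of_lt_of_le (by norm_num) hL
  have hM : 4 * ((2 : ℝ) ^ r) ^ 8 ≤ L := by
    refine le_trans (le_trans (le_of_eq ?_) (two_pow_le_jigsawConst (r := r) (k := 2 + r * 8) ?_))
      h.const_le
    · rw [pow_add, pow_mul]; norm_num
    · nlinarith
  have h1 : 1 ≤ L / (2 ^ r) ^ 4 := by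
    rw [le_div_iff₀ (by positivity), one_mul]
    have : (1 : ℝ) ≤ (2 ^ r) ^ 4 := one_le_pow₀ (one_le_pow₀ (by norm_num))
    nlinarith
  obtain ⟨J, hJ1, hJ2⟩ := exists_nat_pow_near h1 (by norm_num : (1 : ℝ) < 2)
  rw [le_div_iff₀ (by positivity)] at hJ1
  rw [div_lt_iff₀ (by positivity), pow_succ'] at hJ2
  refine ⟨J, hJ1, hJ2.le, ?_⟩
  gcongr
  rw [Real.sqrt_le_left (by positivity)]
  have h3 : L * L ≤ (2 * 2 ^ J * (2 ^ r) ^ 4) * (2 * 2 ^ J * (2 ^ r) ^ 4) :=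
    mul_le_mul hJ2.le hJ2.le hL0.le (by positivity)
  have h4 : L * L ≤ ((2 : ℝ) ^ J) ^ 2 * L := by
    calc L * L ≤ ((2 : ℝ) ^ J) ^ 2 * (4 * ((2 : ℝ) ^ r) ^ 8) := h3.trans (le_of_eq (by ring))
      _ ≤ _ := by gcongr
  exact le_of_mul_le_mul_right h4 hL0

lemma sqrt_facts : 2 ^ 32 ≤ Real.log n ∧ 320 * Real.log n ^ 3 ≤ √n ∧ √n * √n = n := by
  have hL := h.log_ge
  refine ⟨hL, le_trans ?_ h.log_pow_le_sqrt, Real.mul_self_sqrt h.n_pos.le⟩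
  set L := Real.log n
  have hL1 : 1 ≤ L := le_trans (by norm_num) hL
  calc 320 * L ^ 3 ≤ L * L ^ 3 := by gcongr; linarith
    _ = L ^ 4 := by ring
    _ ≤ L ^ 10 := pow_le_pow_right₀ hL1 (by norm_num)

lemma exists_final_exponent {J : ℕ} (hJ : (2 : ℝ) ^ J * (2 ^ r) ^ 4 ≤ Real.log n) :
    ∃ m : ℕ, (2 : ℝ) ^ (J + m) ≤ n / (512 * Real.log n * 2 ^ r) ∧
      n / Real.log n ^ 2 ≤ (2 : ℝ) ^ (J + m) ∧ (m : ℝ) ≤ 2 * Real.log n := by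
  obtain ⟨hL, hs, hsn⟩ := h.sqrt_facts
  have hr := h.two_le
  have hn := h.n_pos
  set L := Real.log n with hLdef
  have hM : 1024 * (2 : ℝ) ^ r ≤ L := by
    refine le_trans (le_trans (le_of_eq ?_) (two_pow_le_jigsawConst (r := r) (k := 10 + r) ?_))
      h.const_le
    · rw [pow_add]; norm_num
    · nlinarith
  have hnL : L ^ 3 ≤ n := by
    have : 0 ≤ L ^ 3 := by positivity
    have h3 : 1 ≤ L ^ 3 := one_le_pow₀ (le_trans (by norm_num) hL)
    nlinarith
  have hJL : (2 : ℝ) ^ J ≤ L := by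
    refine le_trans (le_mul_of_one_le_right (by positivity) ?_) hJ
    exact one_le_pow₀ (one_le_pow₀ (by norm_num))
  have hden : 512 * L * 2 ^ r ≤ L ^ 2 := by nlinarith
  have h0 : L ≤ n / (512 * L * 2 ^ r) := by
    rw [le_div_iff₀ (by positivity)]
    calc L * (512 * L * 2 ^ r) ≤ L * L ^ 2 := by gcongr
      _ = L ^ 3 := by ring
      _ ≤ n := hnL
  obtain ⟨N, hN1, hN2⟩ := exists_nat_pow_near (le_trans (le_trans (by norm_num) hL) h0)
    (by norm_num : (1 : ℝ) < 2)
  have hJN : J ≤ N := by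
    have h1 : (2 : ℝ) ^ J < 2 ^ (N + 1) := (hJL.trans h0).trans_lt hN2
    have := (pow_lt_pow_iff_right₀ (by norm_num : (1 : ℝ) < 2)).1 h1
    omega
  obtain ⟨m, rfl⟩ : ∃ m, N = J + m := ⟨N - J, by omega⟩
  refine ⟨m, hN1, ?_, ?_⟩
  · have h2 : (n : ℝ) / L ^ 2 * 2 ≤ n / (512 * L * 2 ^ r) := by
      rw [div_mul_eq_mul_div, div_le_div_iff₀ (by positivity) (by positivity)]
      have : 2 * (512 * L * 2 ^ r) ≤ L ^ 2 := by nlinarith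
      nlinarith
    rw [pow_succ] at hN2
    linarith
  · have h3 : (2 : ℝ) ^ m ≤ n := by
      calc (2 : ℝ) ^ m ≤ 2 ^ (J + m) := pow_le_pow_right₀ (by norm_num) (by omega)
        _ ≤ n / (512 * L * 2 ^ r) := hN1
        _ ≤ n := div_le_self hn.le (by
            have : (1 : ℝ) ≤ 2 ^ r := one_le_pow₀ (by norm_num)
            nlinarith)
    have h4 := Real.log_le_log (by positivity) h3
    rw [Real.log_pow] at h4
    have h5 := Real.log_two_gt_d9
    rw [← hLdef] at h4
    nlinarith

lemma seeds_fit {J m T g w : ℕ} (hJ : (2 : ℝ) ^ J * (2 ^ r) ^ 4 ≤ Real.log n)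
    (hm : (m : ℝ) ≤ 2 * Real.log n) (hT : T = ⌈√(n : ℝ)⌉₊) (hg : g = ⌈(n : ℝ) / 2 ^ (J + 6)⌉₊)
    (hw : n ≤ 3 * w) :
    T + ∑ j ∈ Finset.range J, (2 ^ (j + 1) * g + T * 2 ^ (J + 1)) +
      ∑ i ∈ Finset.range m, (⌈(n : ℝ) / 2 ^ (i + 6)⌉₊ + ⌈(n : ℝ) / (64 * Real.log n)⌉₊) ≤ w := by
  obtain ⟨hL, hs, hsn⟩ := h.sqrt_facts
  set L := Real.log n with hLdef
  set s := √(n : ℝ)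
  have hJL : (2 : ℝ) ^ J ≤ L := by
    refine le_trans (le_mul_of_one_le_right (by positivity) ?_) hJ
    exact one_le_pow₀ (one_le_pow₀ (by norm_num))
  have hs0 : 0 ≤ s := Real.sqrt_nonneg _
  have hTs : (T : ℝ) ≤ s + 1 := by rw [hT]; exact (Nat.ceil_lt_add_one hs0).le
  have hgs : (g : ℝ) ≤ n / 2 ^ (J + 6) + 1 := by
    rw [hg]; exact (Nat.ceil_lt_add_one (by positivity)).le
  have hJ2 : (J : ℝ) ≤ L := le_trans (by exact_mod_cast (Nat.lt_two_pow_self (n := J)).le) hJL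
  have hgeom : ∀ k : ℕ, ∑ j ∈ Finset.range k, (2 : ℝ) ^ (j + 1) ≤ 2 ^ (k + 1) := by
    intro k
    induction k with
    | zero => simp
    | succ k ih => rw [Finset.sum_range_succ, pow_succ 2 (k + 1)]; linarith
  have hgeom' : ∀ k : ℕ, ∑ i ∈ Finset.range k, (n : ℝ) / 2 ^ (i + 6) ≤ n / 32 - n / 2 ^ (k + 5) := by
    intro k
    induction k with
    | zero => norm_num
    | succ k ih =>
      rw [Finset.sum_range_succ]
      have : (n : ℝ) / 2 ^ (k + 5) = n / 2 ^ (k + 6) + n / 2 ^ (k + 6) := by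
        rw [pow_succ 2 (k + 5)]; field_simp; ring
      have h2 : k + 1 + 5 = k + 6 := by ring
      rw [h2]
      linarith
  have e1 : ∑ j ∈ Finset.range J, ((2 : ℝ) ^ (j + 1) * g + T * 2 ^ (J + 1)) ≤
      n / 32 + 2 * L + 2 * L ^ 2 * (s + 1) := by
    rw [Finset.sum_add_distrib, ← Finset.sum_mul, Finset.sum_const, Finset.card_range, nsmul_eq_mul]
    have a1 : (∑ j ∈ Finset.range J, (2 : ℝ) ^ (j + 1)) * g ≤ 2 ^ (J + 1) * (n / 2 ^ (J + 6) + 1) := by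
      gcongr; exact hgeom J
    have a2 : (2 : ℝ) ^ (J + 1) * (n / 2 ^ (J + 6) + 1) = n / 32 + 2 * 2 ^ J := by
      rw [pow_add, pow_add]; field_simp; norm_num; ring
    have a3 : (J : ℝ) * (T * 2 ^ (J + 1)) ≤ L * ((s + 1) * (2 * L)) := by
      rw [pow_succ']; gcongr
    nlinarith
  have e2 : ∑ i ∈ Finset.range m, ((⌈(n : ℝ) / 2 ^ (i + 6)⌉₊ : ℝ) + ⌈(n : ℝ) / (64 * L)⌉₊) ≤
      n / 32 + n / 32 + 4 * L := by
    have b1 : ∀ i ∈ Finset.range m, ((⌈(n : ℝ) / 2 ^ (i + 6)⌉₊ : ℝ) + ⌈(n : ℝ) / (64 * L)⌉₊) ≤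
        n / 2 ^ (i + 6) + (n / (64 * L) + 2) := fun i _ => by
      have c1 := (Nat.ceil_lt_add_one (show 0 ≤ (n : ℝ) / 2 ^ (i + 6) by positivity)).le
      have c2 := (Nat.ceil_lt_add_one (show 0 ≤ (n : ℝ) / (64 * L) by positivity)).le
      linarith
    refine (Finset.sum_le_sum b1).trans ?_
    rw [Finset.sum_add_distrib, Finset.sum_const, Finset.card_range, nsmul_eq_mul]
    have b2 := hgeom' m
    have b3 : 0 ≤ (n : ℝ) / 2 ^ (m + 5) := by positivity
    have b4 : (m : ℝ) * (n / (64 * L) + 2) ≤ (2 * L) * (n / (64 * L) + 2) := by gcongr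
    have b5 : (2 * L) * (n / (64 * L) + 2) = n / 32 + 4 * L := by field_simp; ring
    linarith
  have hw' : (n : ℝ) ≤ 3 * w := by exact_mod_cast hw
  have hL1 : 1 ≤ L := le_trans (by norm_num) hL
  have f2 : L ^ 2 ≤ L ^ 3 := pow_le_pow_right₀ hL1 (by norm_num)
  have f4 : L ^ 2 * s ≤ L ^ 3 * s := by gcongr
  have f6 : L ^ 3 ≤ L ^ 3 * s := le_mul_of_one_le_right (by positivity) (by nlinarith)
  have total : (T : ℝ) + ∑ j ∈ Finset.range J, ((2 : ℝ) ^ (j + 1) * g + T * 2 ^ (J + 1)) +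
      ∑ i ∈ Finset.range m, ((⌈(n : ℝ) / 2 ^ (i + 6)⌉₊ : ℝ) + ⌈(n : ℝ) / (64 * L)⌉₊) ≤ w := by
    nlinarith
  exact_mod_cast total

/-- In every set of at least a third of the vertices one finds, with high probability and looking
only at the edges within that set, a large set of vertices that are bound to end up in one
cluster. -/
theorem exists_hub {W : Finset (Fin n)} (hW : n ≤ 3 * W.card) :
    ∃ (F : RFoldGraph r (Fin n) → Option (Finset (Fin n))) (b : ℕ),
      n / Real.log n ^ 2 ≤ (b : ℝ) ∧
      (∀ c, DependsOnEdges {G | F G = c} (edgesWithin r W)) ∧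
      (∀ G B, F G = some B → B ⊆ W ∧ B.card = b ∧ ∀ s, G.IsClosed s → ∃ a, ∀ v ∈ B, s a v) ∧
      (rFoldBinomial n p).real {G | F G = none} ≤ 1 / Real.log n + 1 / √(Real.log n) := by
  obtain ⟨J, hJ1, hJ2, hJ3⟩ := h.exists_critical_exponent
  obtain ⟨m, hm1, hm2, hm3⟩ := h.exists_final_exponent hJ1
  obtain ⟨hL, hs, hsn⟩ := h.sqrt_facts
  have hn := h.n_pos
  set g := ⌈(n : ℝ) / 2 ^ (J + 6)⌉₊ with hg
  set T := ⌈√(n : ℝ)⌉₊ with hT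
  have hfit := h.seeds_fit hJ1 hm3 hT hg hW
  set L := Real.log n with hLdef
  have hL0 : 0 < L := lt_of_lt_of_le (by norm_num) hL
  set N₁ := ∑ j ∈ Finset.range J, (2 ^ (j + 1) * g + T * 2 ^ (J + 1)) with hN₁
  set ρ₂ : ℕ → ℕ := fun i => ⌈(n : ℝ) / 2 ^ (i + 6)⌉₊ + ⌈(n : ℝ) / (64 * L)⌉₊ with hρ₂
  obtain ⟨S, hSW, hS⟩ := Finset.exists_subset_card_eq (s := W) (n := T) (by omega)
  obtain ⟨W₁, hW₁, hW₁c⟩ := Finset.exists_subset_card_eq (s := W \ S) (n := N₁)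
    (by rw [Finset.card_sdiff_of_subset hSW]; omega)
  obtain ⟨R₁, hR₁, hR₁d⟩ := exists_layers W₁ _ J hW₁c.ge
  have hfit₂ : ∑ j ∈ Finset.range m, ρ₂ j ≤ W.card - (T + N₁) :=
    Nat.le_sub_of_add_le (by rw [add_comm]; exact hfit)
  obtain ⟨R₂, hR₂, hR₂d⟩ := exists_layers ((W \ S) \ W₁) ρ₂ m (by
    rw [Finset.card_sdiff_of_subset hW₁, Finset.card_sdiff_of_subset hSW]
    exact hfit₂.trans (by omega))
  set q₁ : ℕ → ℝ := fun j => ((1 / 2 : ℝ) ^ ((r + 1) * (J - j) + 1)) ^ (2 ^ (j + 1)) with hq₁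
  set x₁ : ℕ → ℕ := fun j => 2 ^ j with hx₁
  set x₂ : ℕ → ℕ := fun i => 2 ^ (J + i) with hx₂
  have hq₁0 : ∀ j < J, 0 ≤ q₁ j := fun j _ => by positivity
  have hq₁1 : ∀ j < J, q₁ j ≤ 1 := fun j _ =>
    pow_le_one₀ (by positivity) (pow_le_one₀ (by norm_num) (by norm_num))
  have hT1 : territory R₁ S.toList.toFinset J ⊆ S ∪ W₁ := by
    rw [Finset.toList_toFinset]
    refine Finset.union_subset_union_right (Finset.biUnion_subset.2 fun j hj => ?_)
    exact (hR₁ j (by simpa using hj)).2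
  have htrials : (rFoldBinomial n p).real {G | G.trials x₁ J S.toList R₁ = none} ≤ 1 / L := by
    have h1 := real_trials_eq_none_le (p := p) (R := R₁) (x := x₁) (m := J) (vs := S.toList)
      (q := q₁) (ρ := fun j => 2 ^ (j + 1) * g) (Y := 2 ^ (J + 1)) (by simp [hx₁]) ?_ hq₁0 hq₁1 ?_
      S.nodup_toList ?_ hR₁d ?_
    · refine h1.trans ?_
      have h2 := h.exp_neg_le_prod hJ1
      have h3 : 0 ≤ 1 - ∏ j ∈ Finset.range J, q₁ j := by
        have := Finset.prod_le_one (s := Finset.range J) (f := q₁)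
          (fun j hj => hq₁0 j (by simpa using hj)) (fun j hj => hq₁1 j (by simpa using hj))
        linarith
      rw [Finset.length_toList, hS]
      calc (1 - ∏ j ∈ Finset.range J, q₁ j) ^ T
          ≤ Real.exp (-(T * ∏ j ∈ Finset.range J, q₁ j)) :=
            one_sub_pow_le_exp (by linarith) _
        _ ≤ Real.exp (-(Real.exp (L / 2) * Real.exp (-(L / 4)))) := by
            gcongr
            rw [show Real.exp (L / 2) = √(n : ℝ) by
              rw [hLdef, Real.exp_half, Real.exp_log hn]]
            exact Nat.le_ceil _
        _ ≤ Real.exp (-Real.log L) := by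
            gcongr
            rw [← Real.exp_add]
            have h4 := Real.add_one_le_exp (L / 2 + -(L / 4))
            have h5 : Real.log L ≤ √ L * 2 := by
              rw [← Real.sq_sqrt hL0.le, Real.log_pow, Real.sqrt_sq (Real.sqrt_nonneg _)]
              have := Real.log_le_sub_one_of_pos (Real.sqrt_pos.2 hL0)
              push_cast
              linarith
            have h6 : 8 ≤ √L := Real.le_sqrt_of_sq_le (le_trans (by norm_num) hL)
            have h7 : √L * √L = L := Real.mul_self_sqrt hL0.le
            nlinarith
        _ = 1 / L := by rw [Real.exp_neg, Real.exp_log hL0, one_div]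
    · rw [Nat.geomSum_eq le_rfl]; simp
    · intro j hj B R' hB hd hR'
      refine le_trans ?_ (pow_le_real_le_card_attached (p := p) (g := g) (x₁ (j + 1)) hd hR')
      rw [hB]
      exact pow_le_pow_left₀ (by positivity) (h.small_growth hj hJ1 hJ2 (Nat.le_ceil _)) _
    · intro v hv j hj hvj
      have h1 := hW₁ ((hR₁ j hj).2 hvj)
      exact (Finset.mem_sdiff.1 h1).2 (by simpa using hv)
    · intro j hj
      rw [(hR₁ j hj).1, Finset.length_toList, hS]
  refine ⟨fun G => (G.trials x₁ J S.toList R₁).bind (fun A => G.run R₂ x₂ A m), 2 ^ (J + m),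
    by exact_mod_cast hm2, ?_, ?_, ?_⟩
  · intro c G G' hGG' hG
    simp only [Set.mem_ofPred_eq] at hG ⊢
    rw [← hG, trials_congr_of_within (G := G') (G' := G) (W := W)
      (fun e he => (hGG' e he).symm)]
    · refine Option.bind_congr fun A hA => ?_
      refine run_congr_of_within (W := W) (fun e he => (hGG' e he).symm) (Finset.union_subset
        ((subset_territory_of_trials_eq_some hA).trans (hT1.trans (Finset.union_subset hSW
        (hW₁.trans Finset.sdiff_subset)))) (Finset.biUnion_subset.2 fun j hj => ?_)) le_rfl
      exact (hR₂ j (by simpa using hj)).2.trans (Finset.sdiff_subset.trans Finset.sdiff_subset)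
    · exact hT1.trans (Finset.union_subset hSW (hW₁.trans Finset.sdiff_subset))
  · intro G B hB
    rw [Option.bind_eq_some_iff] at hB
    obtain ⟨A, hA, hB⟩ := hB
    refine ⟨(subset_territory_of_run_eq_some hB).trans (Finset.union_subset
        ((subset_territory_of_trials_eq_some hA).trans (hT1.trans (Finset.union_subset hSW
        (hW₁.trans Finset.sdiff_subset)))) (Finset.biUnion_subset.2 fun j hj => ?_)), ?_, ?_⟩
    · exact (hR₂ j (by simpa using hj)).2.trans (Finset.sdiff_subset.trans Finset.sdiff_subset)
    · exact card_of_run_eq_some (x := x₂) (j := m) (show A.card = x₂ 0 from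
        (card_of_trials_eq_some (by simp [hx₁]) hA).trans (by simp [hx₁, hx₂])) hB
    · intro s hs
      obtain ⟨a, ha⟩ := trials_eq_some_class hs hA
      exact ⟨a, run_eq_some_class hs ha hB⟩
  · have hf0 : ∀ j < m, (0 : ℝ) ≤ 1 / 2 ^ (J + j + 1) := fun j _ => by positivity
    have hf1 : ∀ j < m, (1 : ℝ) / 2 ^ (J + j + 1) ≤ 1 := fun j _ => by
      rw [div_le_one (by positivity)]; exact one_le_pow₀ (by norm_num)
    have h1 := real_trials_bind_run_eq_none_le (p := p) (x₂ := x₂) (m₂ := m) (R₂ := R₂)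
      (q₂ := fun j => 1 - 1 / 2 ^ (J + j + 1)) (by simp [hx₁]) (by simp [hx₁, hx₂]) htrials
      (fun j hj => by linarith [hf1 j hj]) (fun j hj => by linarith [hf0 j hj]) ?_ hR₂d ?_
    · refine h1.trans (add_le_add le_rfl ?_)
      have h2 := one_sub_sum_le_prod hf0 hf1
      have h3 : ∀ k : ℕ, ∑ j ∈ Finset.range k, (1 : ℝ) / 2 ^ (J + j + 1) ≤
          1 / 2 ^ J - 1 / 2 ^ (J + k) := by
        intro k
        induction k with
        | zero => simp
        | succ k ih =>
          rw [Finset.sum_range_succ]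
          have : (1 : ℝ) / 2 ^ (J + k) = 1 / 2 ^ (J + k + 1) + 1 / 2 ^ (J + k + 1) := by
            rw [pow_succ 2 (J + k)]; field_simp; ring
          rw [← add_assoc]
          linarith
      have h4 := h3 m
      have h5 : (0 : ℝ) ≤ 1 / 2 ^ (J + m) := by positivity
      linarith
    · intro j hj
      refine Finset.disjoint_of_subset_left hT1 (Finset.disjoint_right.2 fun v hv hv' => ?_)
      have h1 := (hR₂ j hj).2 hv
      simp only [Finset.mem_sdiff] at h1
      rcases Finset.mem_union.1 hv' with h2 | h2
      exacts [h1.1.2 h2, h1.2 h2]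
    · intro j hj B hB hd
      have h2 := real_card_attached_lt_le (p := p) (x₂ (j + 1)) hd
      have h3 := real_compl (p := p) {G | (G.attached B (R₂ j)).card < x₂ (j + 1)}
      have h4 : {G : RFoldGraph r (Fin n) | (G.attached B (R₂ j)).card < x₂ (j + 1)}ᶜ =
        {G | x₂ (j + 1) ≤ (G.attached B (R₂ j)).card} := by ext G; simp
      rw [h4] at h3
      rw [h3]
      refine sub_le_sub_left (h2.trans ?_) _
      rw [hB, (hR₂ j hj).1]
      have h5 := h.large_growth (i := j) (ρ := ρ₂ j) hJ2
        ((pow_le_pow_right₀ (by norm_num) (by omega)).trans hm1)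
        (by rw [hρ₂]; push_cast; exact (Nat.le_ceil _).trans (le_add_of_nonneg_right (Nat.cast_nonneg _)))
        (by rw [hρ₂]; push_cast; exact (Nat.le_ceil _).trans (le_add_of_nonneg_left (Nat.cast_nonneg _)))
      set a := attachProb p (x₂ j) with ha
      have ha1 : a ≤ 1 := attachProb_le_one _
      have h6 : x₂ (j + 1) = 2 * 2 ^ (J + j) := by simp only [hx₂]; ring
      set X : ℝ := 2 ^ (J + j) with hX
      have h7 : (2 : ℝ) ^ (x₂ (j + 1)) ≤ Real.exp (2 * X) := by
        have : (2 : ℝ) ≤ Real.exp 1 := by linarith [Real.add_one_le_exp 1]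
        refine (pow_le_pow_left₀ (by norm_num) this _).trans (le_of_eq ?_)
        rw [← Real.exp_nat_mul, h6]
        push_cast
        rw [mul_one]
      have h8 : (1 - a / 2) ^ ρ₂ j ≤ Real.exp (-(4 * X)) := by
        refine (one_sub_pow_le_exp (by linarith) _).trans ?_
        refine Real.exp_le_exp.2 ?_
        have : 8 * X ≤ ρ₂ j * a := h5
        linarith
      calc (2 : ℝ) ^ (x₂ (j + 1)) * (1 - a / 2) ^ ρ₂ j
          ≤ Real.exp (2 * X) * Real.exp (-(4 * X)) := by
            gcongr
            exact pow_nonneg (by linarith) _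
        _ = (Real.exp (2 * X))⁻¹ := by rw [← Real.exp_add, ← Real.exp_neg]; ring_nf
        _ ≤ (2 * X)⁻¹ := by
            gcongr
            linarith [Real.add_one_le_exp (2 * X)]
        _ = 1 / 2 ^ (J + j + 1) := by rw [pow_succ' 2 (J + j), one_div]

end Supercritical

lemma real_no_adj (i : Fin r) {A B : Finset (Fin n)} (h : Disjoint A B) :
    (rFoldBinomial n p).real {G | ∀ v ∈ B, ¬ ∃ u ∈ A, (G i).Adj u v} =
      ((1 - (p i : ℝ)) ^ A.card) ^ B.card := by
  have := real_biInter_of_dependsOnEdges (p := p) B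
    (E := fun v => {G : RFoldGraph r (Fin n) | ∃ u ∈ A, (G i).Adj u v}ᶜ)
    (fun v _ => (dependsOnEdges_exists_adj i A v).compl) ?_
  · refine Eq.trans this ?_
    rw [Finset.prod_congr rfl (g := fun _ => (1 - (p i : ℝ)) ^ A.card), Finset.prod_const]
    intro v hv
    rw [real_compl, real_exists_adj i (Finset.disjoint_right.1 h hv)]
    ring
  · intro v hv w hw hvw
    refine Set.disjoint_left.2 ?_
    rintro x ⟨-, a, ha, hx⟩ ⟨-, b, hb, hx'⟩
    rw [hx, Sym2.eq_iff] at hx'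
    rcases hx' with ⟨-, h1⟩ | ⟨h1, -⟩
    · exact hvw h1
    · exact Finset.disjoint_left.1 h ha (h1 ▸ hw)

lemma exists_small_separated {G : SimpleGraph (Fin n)} (hG : ¬ G.Preconnected) :
    ∃ S : Finset (Fin n), S.Nonempty ∧ 2 * S.card ≤ n ∧ ∀ v ∈ Sᶜ, ¬ ∃ u ∈ S, G.Adj u v := by
  classical
  simp only [SimpleGraph.Preconnected, not_forall] at hG
  obtain ⟨a, b, hab⟩ := hG
  set S : Finset (Fin n) := Finset.univ.filter fun w => G.Reachable a w with hS
  have hmem : ∀ w, w ∈ S ↔ G.Reachable a w := fun w => by simp [hS]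
  have hsep : ∀ u v, G.Adj u v → (u ∈ S ↔ v ∈ S) := fun u v huv => by
    rw [hmem, hmem]
    exact ⟨fun h => h.trans huv.reachable, fun h => h.trans huv.symm.reachable⟩
  have hcard := Finset.card_compl_add_card S
  rw [Fintype.card_fin] at hcard
  rcases le_total S.card Sᶜ.card with h | h
  · refine ⟨S, ⟨a, (hmem a).2 (SimpleGraph.Reachable.refl _)⟩, by omega, ?_⟩
    rintro v hv ⟨u, hu, huv⟩
    exact Finset.mem_compl.1 hv ((hsep u v huv).1 hu)
  · refine ⟨Sᶜ, ⟨b, by simpa [hmem] using hab⟩, by omega, ?_⟩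
    rintro v hv ⟨u, hu, huv⟩
    rw [compl_compl] at hv
    exact Finset.mem_compl.1 hu ((hsep u v huv).2 hv)

lemma real_not_preconnected_le (i : Fin r) (hn : 1 ≤ n) (hp : 4 * Real.log n / n ≤ p i) :
    (rFoldBinomial n p).real {G | ¬ (G i).Preconnected} ≤ 2 / n := by
  classical
  have hn0 : (0 : ℝ) < n := by exact_mod_cast hn
  set t : ℝ := 1 / n ^ 2 with ht
  have hsub : {G : RFoldGraph r (Fin n) | ¬ (G i).Preconnected} ⊆
      ⋃ S ∈ (Finset.univ : Finset (Finset (Fin n))).filter (fun S => S.Nonempty ∧ 2 * S.card ≤ n),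
        {G | ∀ v ∈ Sᶜ, ¬ ∃ u ∈ S, (G i).Adj u v} := by
    intro G hG
    obtain ⟨S, h1, h2, h3⟩ := exists_small_separated hG
    exact Set.mem_biUnion (by simpa using ⟨h1, h2⟩) h3
  have hterm : ∀ S ∈ (Finset.univ : Finset (Finset (Fin n))).filter
      (fun S => S.Nonempty ∧ 2 * S.card ≤ n),
      (rFoldBinomial n p).real {G | ∀ v ∈ Sᶜ, ¬ ∃ u ∈ S, (G i).Adj u v} ≤ t ^ S.card := by
    intro S hS
    simp only [Finset.mem_filter, Finset.mem_univ, true_and] at hS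
    rw [real_no_adj i disjoint_compl_right, ← pow_mul, mul_comm, pow_mul]
    have hp1 : (0 : ℝ) ≤ 1 - p i := sub_nonneg.2 (p i).2.2
    refine pow_le_pow_left₀ (pow_nonneg hp1 _) ((one_sub_pow_le_exp (p i).2.2 _).trans ?_) _
    rw [ht, ← Real.exp_log (show (0 : ℝ) < 1 / n ^ 2 by positivity), one_div, Real.log_inv, Real.log_pow]
    refine Real.exp_le_exp.2 (neg_le_neg ?_)
    have hcard : (n : ℝ) / 2 ≤ (Sᶜ.card : ℝ) := by
      have h1 := Finset.card_compl_add_card S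
      rw [Fintype.card_fin] at h1
      have h2 : (n : ℝ) ≤ 2 * Sᶜ.card := by exact_mod_cast (by omega : n ≤ 2 * Sᶜ.card)
      linarith
    calc ((2 : ℕ) : ℝ) * Real.log n = (n / 2) * (4 * Real.log n / n) := by
          field_simp; push_cast; ring
      _ ≤ Sᶜ.card * (p i : ℝ) := by
          have : 0 ≤ Real.log n := Real.log_natCast_nonneg n
          gcongr
  have hsum : ∑ S ∈ (Finset.univ : Finset (Finset (Fin n))).filter
      (fun S => S.Nonempty ∧ 2 * S.card ≤ n), t ^ S.card ≤ (1 + t) ^ n - 1 := by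
    have h1 := Finset.sum_pow_mul_eq_add_pow t 1 (Finset.univ : Finset (Fin n))
    simp only [one_pow, mul_one, Finset.card_univ, Fintype.card_fin] at h1
    rw [add_comm 1 t, ← h1, le_sub_iff_add_le]
    have h2 : insert ∅ ((Finset.univ : Finset (Finset (Fin n))).filter
      (fun S => S.Nonempty ∧ 2 * S.card ≤ n)) ⊆ Finset.univ.powerset := by simp
    refine le_trans (le_of_eq ?_) (Finset.sum_le_sum_of_subset_of_nonneg h2 fun S _ _ => by positivity)
    rw [Finset.sum_insert (by simp)]
    simp [add_comm]
  calc _ ≤ _ := measureReal_mono hsub (measure_ne_top _ _)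
    _ ≤ _ := measureReal_biUnion_finset_le _ _
    _ ≤ _ := Finset.sum_le_sum hterm
    _ ≤ _ := hsum
    _ ≤ Real.exp (1 / n) - 1 := by
        refine sub_le_sub_right ?_ _
        calc (1 + t) ^ n ≤ Real.exp t ^ n :=
              pow_le_pow_left₀ (by positivity) (by linarith [Real.add_one_le_exp t]) _
          _ = Real.exp (1 / n) := by
              rw [← Real.exp_nat_mul, ht]; congr 1; field_simp
    _ ≤ 2 / n := by
        have h1 : (1 : ℝ) / n ≤ 1 := by rw [div_le_one hn0]; exact_mod_cast hn
        have h2 := Real.abs_exp_sub_one_le (x := 1 / n) (by rw [abs_of_nonneg (by positivity)]; exact h1)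
        rw [abs_of_nonneg (show (0 : ℝ) ≤ 1 / n by positivity)] at h2
        refine (le_abs_self _).trans (h2.trans (le_of_eq (by ring)))

/-- Two hubs see each other in colour `i₀`, and every vertex on the opposite side in all the other
colours. -/
def HubsLinked {V : Type*} (G : RFoldGraph r V) (i₀ : Fin r) (W₁ W₂ B₁ B₂ : Finset V) : Prop :=
  (∃ v ∈ B₂, ∃ u ∈ B₁, (G i₀).Adj u v) ∧
    (∀ w ∈ W₂, ∀ i, i ≠ i₀ → ∃ u ∈ B₁, (G i).Adj u w) ∧
    (∀ w ∈ W₁, ∀ i, i ≠ i₀ → ∃ u ∈ B₂, (G i).Adj u w)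

lemma dependsOnEdges_hubsLinked {i₀ : Fin r} {W₁ W₂ B₁ B₂ : Finset (Fin n)} (h₁ : B₁ ⊆ W₁)
    (h₂ : B₂ ⊆ W₂) :
    DependsOnEdges {G : RFoldGraph r (Fin n) | G.HubsLinked i₀ W₁ W₂ B₁ B₂}
      (edgesBetween r W₁ W₂) := by
  intro G G' hG
  have key : ∀ i, ∀ u ∈ W₁, ∀ v ∈ W₂, (G i).Adj u v → (G' i).Adj u v := fun i u hu v hv huv =>
    (hG (i, s(u, v)) ⟨u, hu, v, hv, rfl⟩).1 huv
  rintro ⟨⟨v, hv, u, hu, huv⟩, h3, h4⟩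
  refine ⟨⟨v, hv, u, hu, key _ u (h₁ hu) v (h₂ hv) huv⟩, fun w hw i hi => ?_, fun w hw i hi => ?_⟩
  · obtain ⟨x, hx, hxw⟩ := h3 w hw i hi
    exact ⟨x, hx, key i x (h₁ hx) w hw hxw⟩
  · obtain ⟨x, hx, hxw⟩ := h4 w hw i hi
    exact ⟨x, hx, (key i w hw x (h₂ hx) hxw.symm).symm⟩

lemma real_exists_not_adj_le {i₀ : Fin r} {B W : Finset (Fin n)} (h : Disjoint B W) {δ : ℝ}
    (hδ0 : 0 ≤ δ) (hδ : ∀ i, i ≠ i₀ → (1 - (p i : ℝ)) ^ B.card ≤ δ) :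
    (rFoldBinomial n p).real {G | ¬ ∀ w ∈ W, ∀ i, i ≠ i₀ → ∃ u ∈ B, (G i).Adj u w} ≤
      W.card * (r * δ) := by
  classical
  have hsub : {G : RFoldGraph r (Fin n) | ¬ ∀ w ∈ W, ∀ i, i ≠ i₀ → ∃ u ∈ B, (G i).Adj u w} ⊆
      ⋃ w ∈ W, ⋃ i ∈ Finset.univ.filter (fun i : Fin r => i ≠ i₀),
        {G : RFoldGraph r (Fin n) | ∃ u ∈ B, (G i).Adj u w}ᶜ := by
    intro G hG
    simp only [Set.mem_ofPred_eq, not_forall] at hG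
    obtain ⟨w, hw, i, hi, hiw⟩ := hG
    exact Set.mem_biUnion hw (Set.mem_biUnion (by simpa using hi) hiw)
  refine (measureReal_mono hsub (measure_ne_top _ _)).trans ((measureReal_biUnion_finset_le _ _).trans ?_)
  rw [← nsmul_eq_mul]
  refine Finset.sum_le_card_nsmul _ _ _ fun w hw => (measureReal_biUnion_finset_le _ _).trans ?_
  have h1 : ∀ i ∈ Finset.univ.filter (fun i : Fin r => i ≠ i₀), (rFoldBinomial n p).real
      {G : RFoldGraph r (Fin n) | ∃ u ∈ B, (G i).Adj u w}ᶜ ≤ δ := by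
    intro i hi
    rw [real_compl, real_exists_adj i (Finset.disjoint_right.1 h hw)]
    have := hδ i (by simpa using hi)
    linarith
  refine (Finset.sum_le_sum h1).trans ?_
  rw [Finset.sum_const, nsmul_eq_mul]
  gcongr
  exact (Finset.card_le_univ _).trans (by simp)

namespace Supercritical

variable (h : Supercritical n p)
include h

lemma le_first {i₀ : Fin r} (hi₀ : i₀.val = 0) :
    jigsawConst r * Real.log n / n ≤ p i₀ := by
  have h1 := h.one
  have h2 : Finset.univ.filter (fun j : Fin r => j.val < 1) = {i₀} := by
    ext j; simp [Fin.ext_iff, hi₀]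
  rwa [probProd, h2, Finset.prod_singleton] at h1

lemma le_other_sq {i₀ i : Fin r} (hi₀ : i₀.val = 0) (hi : i ≠ i₀) :
    1 / (n * Real.log n) ≤ (p i : ℝ) ^ 2 := by
  have hr := h.two_le
  have h1 := h.ge_two 2 le_rfl hr
  have h2 : Finset.univ.filter (fun j : Fin r => j.val < 2) = {i₀, ⟨1, by omega⟩} := by
    ext j; simp only [Finset.mem_filter, Finset.mem_univ, true_and, Finset.mem_insert,
      Finset.mem_singleton, Fin.ext_iff, hi₀]; omega
  rw [probProd, h2, Finset.prod_pair (by simp [Fin.ext_iff, hi₀])] at h1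
  have hi1 : 1 ≤ i.val := by
    rcases Nat.eq_zero_or_pos i.val with h0 | h0
    · exact absurd (Fin.ext (h0.trans hi₀.symm)) hi
    · exact h0
  have h3 : (p i₀ : ℝ) ≤ p i := h.mono (Fin.le_def.2 (by omega))
  have h4 : (p ⟨1, by omega⟩ : ℝ) ≤ p i := h.mono (Fin.le_def.2 hi1)
  have h5 : (p i₀ : ℝ) * p ⟨1, by omega⟩ ≤ (p i : ℝ) ^ 2 := by
    rw [sq]
    exact mul_le_mul h3 h4 (p _).2.1 (p _).2.1
  refine le_trans ?_ (h1.trans h5)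
  have hL : 0 < Real.log n := lt_of_lt_of_le (by norm_num) h.log_ge
  rw [pow_one]
  gcongr
  exact one_le_pow₀ (by norm_num)

lemma real_not_hubsLinked_le {i₀ : Fin r} (hi₀ : i₀.val = 0) {W₁ W₂ B₁ B₂ : Finset (Fin n)} {b : ℕ}
    (hb : n / Real.log n ^ 2 ≤ (b : ℝ)) {b' : ℕ} (hb' : n / Real.log n ^ 2 ≤ (b' : ℝ))
    (hW : Disjoint W₁ W₂) (hB₁ : B₁ ⊆ W₁) (hB₂ : B₂ ⊆ W₂) (hc₁ : B₁.card = b) (hc₂ : B₂.card = b') :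
    (rFoldBinomial n p).real {G | ¬ G.HubsLinked i₀ W₁ W₂ B₁ B₂} ≤ 3 / Real.log n := by
  obtain ⟨hL, hs, hsn⟩ := h.sqrt_facts
  have hn := h.n_pos
  have hs10 := h.log_pow_le_sqrt
  have hfirst := h.le_first hi₀
  set L := Real.log n with hLdef
  have hL0 : 0 < L := lt_of_lt_of_le (by norm_num) hL
  have hL1 : 1 ≤ L := le_trans (by norm_num) hL
  have hn20 : L ^ 20 ≤ n := by
    rw [← hsn]
    calc L ^ 20 = L ^ 10 * L ^ 10 := by ring
      _ ≤ _ := by gcongr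
  have hrL : (r : ℝ) ≤ L := by
    refine le_trans ?_ ((two_pow_le_jigsawConst (r := r) (k := r) (by nlinarith [h.two_le])).trans
      h.const_le)
    exact_mod_cast (Nat.lt_two_pow_self (n := r)).le
  have hother : ∀ c : ℕ, n / L ^ 2 ≤ (c : ℝ) → ∀ i, i ≠ i₀ →
      (1 - (p i : ℝ)) ^ c ≤ 1 / n ^ 2 := by
    intro c hc i hi
    refine (one_sub_pow_le_exp (p i).2.2 c).trans ?_
    have h1 : 2 * L ≤ c * p i := by
      refine le_of_sq_le_sq ?_ (mul_nonneg (Nat.cast_nonneg _) (p i).2.1)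
      calc (2 * L) ^ 2 = 4 * L ^ 2 := by ring
        _ ≤ L * L ^ 2 := by gcongr; linarith
        _ = L ^ 3 := by ring
        _ ≤ L ^ 15 := pow_le_pow_right₀ hL1 (by norm_num)
        _ = L ^ 20 / L ^ 5 := by field_simp
        _ ≤ n / L ^ 5 := by gcongr
        _ = (n / L ^ 2) ^ 2 * (1 / (n * L)) := by field_simp
        _ ≤ (c : ℝ) ^ 2 * (p i : ℝ) ^ 2 := by
            gcongr
            exact h.le_other_sq hi₀ hi
        _ = _ := by ring
    calc Real.exp (-(c * p i)) ≤ Real.exp (-(2 * L)) := Real.exp_le_exp.2 (by linarith)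
      _ = 1 / n ^ 2 := by
          rw [Real.exp_neg, hLdef, show 2 * Real.log n = Real.log (n ^ 2) by
            rw [Real.log_pow]; norm_num, Real.exp_log (by positivity), one_div]
  have hd : Disjoint B₁ B₂ := (hW.mono_left hB₁).mono_right hB₂
  have hside : ∀ (B W : Finset (Fin n)) (c : ℕ), n / L ^ 2 ≤ (c : ℝ) → B.card = c → Disjoint B W →
      (rFoldBinomial n p).real {G | ¬ ∀ w ∈ W, ∀ i, i ≠ i₀ → ∃ u ∈ B, (G i).Adj u w} ≤ 1 / L := by
    intro B W c hc hBc hBW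
    refine (real_exists_not_adj_le hBW (δ := 1 / n ^ 2) (by positivity)
      (fun i hi => by rw [hBc]; exact hother c hc i hi)).trans ?_
    have hWn : (W.card : ℝ) ≤ n := by
      have := Finset.card_le_univ W
      rw [Fintype.card_fin] at this
      exact_mod_cast this
    calc (W.card : ℝ) * (r * (1 / n ^ 2)) ≤ n * (L * (1 / n ^ 2)) := by gcongr
      _ = L / n := by field_simp
      _ ≤ L / L ^ 2 := by
          gcongr
          exact (pow_le_pow_right₀ hL1 (by norm_num)).trans hn20
      _ = 1 / L := by field_simp
  have hmain : (rFoldBinomial n p).real {G | ∀ v ∈ B₂, ¬ ∃ u ∈ B₁, (G i₀).Adj u v} ≤ 1 / L := by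
    rw [real_no_adj i₀ hd, hc₁, hc₂, ← pow_mul]
    refine (one_sub_pow_le_exp (p i₀).2.2 _).trans ?_
    have h1 : Real.log L ≤ ((b * b' : ℕ) : ℝ) * p i₀ := by
      have hC1 : 1 ≤ jigsawConst r := one_le_pow₀ (by norm_num)
      calc Real.log L ≤ L := (Real.log_le_sub_one_of_pos hL0).trans (by linarith)
        _ ≤ L ^ 17 := le_self_pow₀ hL1 (by norm_num)
        _ = L ^ 20 / L ^ 3 := by field_simp
        _ ≤ n / L ^ 3 := by gcongr
        _ = (n / L ^ 2) * (n / L ^ 2) * (1 * L / n) := by field_simp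
        _ ≤ (b * b') * (jigsawConst r * L / n) := by gcongr
        _ ≤ _ := by push_cast; gcongr
    calc Real.exp (-(((b * b' : ℕ) : ℝ) * p i₀)) ≤ Real.exp (-Real.log L) :=
          Real.exp_le_exp.2 (by linarith)
      _ = 1 / L := by rw [Real.exp_neg, Real.exp_log hL0, one_div]
  have hsub : {G : RFoldGraph r (Fin n) | ¬ G.HubsLinked i₀ W₁ W₂ B₁ B₂} ⊆
      {G | ∀ v ∈ B₂, ¬ ∃ u ∈ B₁, (G i₀).Adj u v} ∪
      ({G | ¬ ∀ w ∈ W₂, ∀ i, i ≠ i₀ → ∃ u ∈ B₁, (G i).Adj u w} ∪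
        {G | ¬ ∀ w ∈ W₁, ∀ i, i ≠ i₀ → ∃ u ∈ B₂, (G i).Adj u w}) := by
    intro G hG
    by_contra hc
    simp only [Set.mem_union, Set.mem_ofPred_eq, not_or, not_not] at hc
    refine hG ⟨?_, hc.2.1, hc.2.2⟩
    have h1 := hc.1
    push Not at h1
    exact h1
  calc _ ≤ _ := measureReal_mono hsub (measure_ne_top _ _)
    _ ≤ _ := measureReal_union_le _ _
    _ ≤ _ := add_le_add hmain ((measureReal_union_le _ _).trans (add_le_add
        (hside B₁ W₂ b hb hc₁ (hW.mono_left hB₁)) (hside B₂ W₁ b' hb' hc₂ (hW.symm.mono_left hB₂))))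
    _ = 3 / L := by ring

/-- Quantitative form of the supercritical statement. -/
theorem real_not_percolates_le :
    (rFoldBinomial n p).real {G | ¬ G.Percolates} ≤ 9 / √(Real.log n) := by
  classical
  obtain ⟨hL, hs, hsn⟩ := h.sqrt_facts
  have hn := h.n_pos
  have hr := h.two_le
  let i₀ : Fin r := ⟨0, by omega⟩
  have hi₀ : i₀.val = 0 := rfl
  have hn3 : 3 ≤ n := by
    by_contra hlt
    have h1 : (n : ℝ) ≤ 2 := by exact_mod_cast (by omega : n ≤ 2)
    have h2 := Real.log_le_sub_one_of_pos hn
    linarith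
  have : NeZero n := ⟨by omega⟩
  obtain ⟨W₁, -, hW₁⟩ := Finset.exists_subset_card_eq (s := (Finset.univ : Finset (Fin n)))
    (n := n / 2) (by simp; omega)
  have hW₂ : (W₁ᶜ).card = n - n / 2 := by rw [Finset.card_compl, hW₁, Fintype.card_fin]
  obtain ⟨F₁, b₁, hb₁, hdep₁, hF₁, hP₁⟩ := h.exists_hub (W := W₁) (by omega)
  obtain ⟨F₂, b₂, hb₂, hdep₂, hF₂, hP₂⟩ := h.exists_hub (W := W₁ᶜ) (by omega)
  have hconn := real_not_preconnected_le (n := n) (p := p) i₀ (by omega) (by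
    refine le_trans ?_ (h.le_first hi₀)
    have : (4 : ℝ) ≤ jigsawConst r :=
      le_trans (by norm_num) (two_pow_le_jigsawConst (r := r) (k := 2) (by nlinarith))
    gcongr)
  let K : Set (Option (Finset (Fin n)) × Option (Finset (Fin n))) :=
    {c | ∃ B₁ B₂, c = (some B₁, some B₂) ∧ B₁ ⊆ W₁ ∧ B₂ ⊆ W₁ᶜ ∧ B₁.card = b₁ ∧ B₂.card = b₂}
  have key := real_condition_le_mul (p := p) (f := fun G => (F₁ G, F₂ G)) (K := K)
    (E := fun c => {G | ¬ G.HubsLinked i₀ W₁ W₁ᶜ (c.1.getD ∅) (c.2.getD ∅)})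
    (S := fun _ => edgesWithin r W₁ ∪ edgesWithin r W₁ᶜ) (T := fun _ => edgesBetween r W₁ W₁ᶜ)
    (c := 3 / Real.log n) ?_ ?_ ?_ ?_
  · have hsub : {G : RFoldGraph r (Fin n) | ¬ G.Percolates} ⊆
        (({G | F₁ G = none} ∪ {G | F₂ G = none}) ∪ {G | ¬ (G i₀).Preconnected}) ∪
        {G | (F₁ G, F₂ G) ∈ K ∧
          ¬ G.HubsLinked i₀ W₁ W₁ᶜ ((F₁ G).getD ∅) ((F₂ G).getD ∅)} := by
      intro G hG
      by_contra hc
      simp only [Set.mem_union, Set.mem_ofPred_eq, not_or, not_not, not_and] at hc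
      obtain ⟨⟨⟨h1, h2⟩, h3⟩, h4⟩ := hc
      obtain ⟨B₁, hB₁⟩ := Option.ne_none_iff_exists'.1 h1
      obtain ⟨B₂, hB₂⟩ := Option.ne_none_iff_exists'.1 h2
      obtain ⟨s1, c1, k1⟩ := hF₁ G B₁ hB₁
      obtain ⟨s2, c2, k2⟩ := hF₂ G B₂ hB₂
      have h5 := h4 ⟨B₁, B₂, by rw [hB₁, hB₂], s1, s2, c1, c2⟩
      rw [hB₁, hB₂] at h5
      obtain ⟨⟨v, hv, u, hu, huv⟩, h6, h7⟩ := h5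
      simp only [Option.getD_some] at hv hu h6 h7
      refine hG (percolates_of_two_hubs i₀ h3 ⟨u, hu⟩ ⟨v, hv⟩ (fun s hs x hx y hy => ?_)
        (fun s hs x hx y hy => ?_) ⟨u, hu, v, hv, huv⟩ (fun w => ?_) (fun w hw => h6 w (s2 hw)))
      · obtain ⟨a, ha⟩ := k1 s hs
        exact s.trans (s.symm (ha x hx)) (ha y hy)
      · obtain ⟨a, ha⟩ := k2 s hs
        exact s.trans (s.symm (ha x hx)) (ha y hy)
      · by_cases hw : w ∈ W₁
        · exact Or.inr (h7 w hw)
        · exact Or.inl (h6 w (Finset.mem_compl.2 hw))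
    have hL0 : 0 < Real.log n := lt_of_lt_of_le (by norm_num) hL
    have hsL : √(Real.log n) * √(Real.log n) = Real.log n := Real.mul_self_sqrt hL0.le
    have e1 : 7 / Real.log n ≤ 5 / √(Real.log n) := by
      rw [div_le_div_iff₀ hL0 (by positivity)]
      nlinarith
    have e2 : 2 / (n : ℝ) ≤ 2 / Real.log n := by
      gcongr
      exact (Real.log_le_sub_one_of_pos hn).trans (by linarith)
    calc _ ≤ _ := measureReal_mono hsub (measure_ne_top _ _)
      _ ≤ _ := measureReal_union_le _ _
      _ ≤ (((1 / Real.log n + 1 / √(Real.log n)) + (1 / Real.log n + 1 / √(Real.log n))) + 2 / n) +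
          3 / Real.log n := add_le_add ((measureReal_union_le _ _).trans (add_le_add
            ((measureReal_union_le _ _).trans (add_le_add hP₁ hP₂)) hconn))
            (key.trans (mul_le_of_le_one_right (by positivity) measureReal_le_one))
      _ ≤ (((1 / Real.log n + 1 / √(Real.log n)) + (1 / Real.log n + 1 / √(Real.log n))) +
          2 / Real.log n) + 3 / Real.log n := by gcongr
      _ = 7 / Real.log n + 2 / √(Real.log n) := by ring
      _ ≤ 5 / √(Real.log n) + 2 / √(Real.log n) := by gcongr
      _ ≤ 9 / √(Real.log n) := by rw [← add_div]; gcongr; norm_num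
  · rintro ⟨c₁, c₂⟩ - G G' hG hc
    simp only [Set.mem_ofPred_eq, Prod.mk.injEq] at hc ⊢
    exact ⟨hdep₁ c₁ G G' (fun x hx => hG x (Or.inl hx)) hc.1,
      hdep₂ c₂ G G' (fun x hx => hG x (Or.inr hx)) hc.2⟩
  · rintro c ⟨B₁, B₂, rfl, h1, h2, -, -⟩
    exact (dependsOnEdges_hubsLinked h1 h2).compl
  · intro c _
    refine Set.disjoint_union_left.2 ⟨?_, ?_⟩
    · exact (disjoint_edgesBetween_edgesWithin' disjoint_compl_left).symm
    · exact (disjoint_edgesBetween_edgesWithin disjoint_compl_right).symm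
  · rintro c ⟨B₁, B₂, rfl, h1, h2, h3, h4⟩
    exact h.real_not_hubsLinked_le hi₀ hb₁ hb₂ disjoint_compl_right h1 h2 h3 h4

end Supercritical

lemma exists_adj_dist_lt {V : Type*} {G : SimpleGraph V} {v w : V} (h : G.Reachable v w)
    (hvw : v ≠ w) : ∃ u, G.Adj v u ∧ G.dist u w < G.dist v w := by
  obtain ⟨q, hq⟩ := h.exists_walk_length_eq_dist
  cases q with
  | nil => exact absurd rfl hvw
  | @cons _ u _ hadj q =>
    refine ⟨u, hadj, ?_⟩
    rw [SimpleGraph.Walk.length_cons] at hq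
    have := SimpleGraph.dist_le q
    omega

/-- In a connected graph every vertex but the root can choose a parent, and the resulting edges
are distinct. -/
lemma exists_parents {V : Type*} [DecidableEq V] {G : SimpleGraph V} {U : Finset V} {ρ : V}
    (hρ : ρ ∈ U) (h : (G.induce (U : Set V)).Preconnected) :
    ∃ f : U.erase ρ → U, (∀ v : U.erase ρ, G.Adj v (f v)) ∧
      Function.Injective fun v : U.erase ρ => s((v : V), (f v : V)) := by
  set H := G.induce (U : Set V) with hH
  let ρ' : (U : Set V) := ⟨ρ, hρ⟩
  have hpar : ∀ v : U.erase ρ, ∃ w : (U : Set V), G.Adj v w ∧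
      H.dist w ρ' < H.dist ⟨v, Finset.mem_of_mem_erase v.2⟩ ρ' := by
    rintro ⟨v, hv⟩
    have hvU : v ∈ U := Finset.mem_of_mem_erase hv
    exact exists_adj_dist_lt (h ⟨v, hvU⟩ ρ') fun h => Finset.ne_of_mem_erase hv (congrArg Subtype.val h)
  choose f hf hd using hpar
  refine ⟨fun v => ⟨f v, (f v).2⟩, hf, ?_⟩
  intro v w hvw
  simp only [Sym2.eq_iff] at hvw
  rcases hvw with ⟨h1, -⟩ | ⟨h1, h2⟩
  · exact Subtype.ext h1
  · exfalso
    have h3 := hd v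
    have h4 := hd w
    have e1 : f v = ⟨w, Finset.mem_of_mem_erase w.2⟩ := Subtype.ext h2
    have e2 : f w = ⟨v, Finset.mem_of_mem_erase v.2⟩ := Subtype.ext h1.symm
    rw [e1] at h3
    rw [e2] at h4
    omega

lemma real_preconnected_le (i : Fin r) {U : Finset (Fin n)} (hU : U.Nonempty) :
    (rFoldBinomial n p).real {G | ((G i).induce (U : Set (Fin n))).Preconnected} ≤
      (U.card * (p i : ℝ)) ^ (U.card - 1) := by
  classical
  obtain ⟨ρ, hρ⟩ := hU
  let Φ : Finset (U.erase ρ → U) := Finset.univ.filter fun f =>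
    (∀ v : U.erase ρ, (v : Fin n) ≠ f v) ∧ Function.Injective fun v : U.erase ρ => s((v : Fin n), (f v : Fin n))
  have hsub : {G : RFoldGraph r (Fin n) | ((G i).induce (U : Set (Fin n))).Preconnected} ⊆
      ⋃ f ∈ Φ, {G | ∀ v ∈ (Finset.univ : Finset (U.erase ρ)),
        G ∈ {G : RFoldGraph r (Fin n) | (G i).Adj v (f v)}} := by
    intro G hG
    obtain ⟨f, hf, hinj⟩ := exists_parents hρ hG
    exact Set.mem_biUnion (Finset.mem_coe.2 (Finset.mem_filter.2
      ⟨Finset.mem_univ _, fun v => (hf v).ne, hinj⟩)) (fun v _ => hf v)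
  have hcard : (U.erase ρ).card = U.card - 1 := Finset.card_erase_of_mem hρ
  have hterm : ∀ f ∈ Φ, (rFoldBinomial n p).real {G | ∀ v ∈ (Finset.univ : Finset (U.erase ρ)),
        G ∈ {G : RFoldGraph r (Fin n) | (G i).Adj v (f v)}} ≤ (p i : ℝ) ^ (U.card - 1) := by
    intro f hf
    simp only [Φ, Finset.mem_filter, Finset.mem_univ, true_and] at hf
    rw [real_biInter_of_dependsOnEdges _ (S := fun v : U.erase ρ => {(i, s((v : Fin n), (f v : Fin n)))})]
    · rw [Finset.prod_congr rfl fun v _ => real_adj i (hf.1 v), Finset.prod_const, Finset.card_univ,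
        Fintype.card_coe, hcard]
    · intro v _ G G' hG hG'
      simpa using (hG _ rfl).1 (by simpa using hG')
    · intro v _ w _ hvw
      simp only [Set.disjoint_singleton, ne_eq, Prod.mk.injEq, true_and]
      exact fun h => hvw (hf.2 h)
  refine (measureReal_mono hsub (measure_ne_top _ _)).trans
    ((measureReal_biUnion_finset_le _ _).trans ((Finset.sum_le_sum hterm).trans ?_))
  rw [Finset.sum_const, nsmul_eq_mul, mul_pow]
  have hΦ : Φ.card ≤ U.card ^ (U.card - 1) := by
    refine (Finset.card_le_univ _).trans (le_of_eq ?_)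
    rw [Fintype.card_fun, Fintype.card_coe, Fintype.card_coe, hcard]
  have := (p i).2.1
  gcongr
  exact_mod_cast hΦ

lemma real_allConnected_le {U : Finset (Fin n)} {m : ℕ} (hm : m ≤ r) (hU : U.Nonempty) :
    (rFoldBinomial n p).real {G | G.AllConnected U} ≤
      ((U.card : ℝ) ^ m * probProd p m) ^ (U.card - 1) := by
  classical
  have hsub : {G : RFoldGraph r (Fin n) | G.AllConnected U} ⊆
      {G | ∀ i ∈ Finset.univ.filter (fun j : Fin r => j.val < m),
        G ∈ {G : RFoldGraph r (Fin n) | ((G i).induce (U : Set (Fin n))).Preconnected}} :=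
    fun G hG i _ => hG.2 i
  refine (measureReal_mono hsub (measure_ne_top _ _)).trans ?_
  rw [real_biInter_of_dependsOnEdges _ (S := fun i => {x | x.1 = i})]
  · have hcard : (Finset.univ.filter fun j : Fin r => j.val < m).card = m := by
      rw [Fin.card_filter_val_lt]; omega
    calc _ ≤ ∏ i ∈ Finset.univ.filter (fun j : Fin r => j.val < m),
          (U.card * (p i : ℝ)) ^ (U.card - 1) :=
          Finset.prod_le_prod (fun _ _ => measureReal_nonneg) fun i _ => real_preconnected_le i hU
      _ = _ := by
          rw [Finset.prod_pow, Finset.prod_mul_distrib, Finset.prod_const, hcard, probProd]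
  · intro i _ G G' hG hGi
    have : G i = G' i := by
      rw [← SimpleGraph.edgeSet_inj]
      ext e
      exact hG (i, e) rfl
    simp only [Set.mem_ofPred_eq] at hGi ⊢
    rwa [← this]
  · intro i _ j _ hij
    exact Set.disjoint_left.2 fun x hx hx' => hij (hx.symm.trans hx')

lemma real_percolates_le_sum {m k : ℕ} (hm : m ≤ r) (hk : 1 ≤ k) (hkn : k ≤ n) :
    (rFoldBinomial n p).real {G | G.Percolates} ≤
      ∑ l ∈ Finset.Ico k (2 * k), (n.choose l : ℝ) * ((l : ℝ) ^ m * probProd p m) ^ (l - 1) := by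
  classical
  have hsub : {G : RFoldGraph r (Fin n) | G.Percolates} ⊆
      ⋃ l ∈ Finset.Ico k (2 * k), ⋃ U ∈ (Finset.univ : Finset (Fin n)).powersetCard l,
        {G : RFoldGraph r (Fin n) | G.AllConnected U} := by
    intro G hG
    obtain ⟨U, h1, h2, h3⟩ := Percolates.exists_allConnected hG hk (by simpa using hkn)
    exact Set.mem_biUnion (Finset.mem_coe.2 (Finset.mem_Ico.2 ⟨h1, h2⟩)) (Set.mem_biUnion
      (Finset.mem_coe.2 (Finset.mem_powersetCard.2 ⟨Finset.subset_univ _, rfl⟩)) h3)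
  refine (measureReal_mono hsub (measure_ne_top _ _)).trans
    ((measureReal_biUnion_finset_le _ _).trans (Finset.sum_le_sum fun l hl => ?_))
  refine (measureReal_biUnion_finset_le _ _).trans ?_
  have hl1 : 1 ≤ l := hk.trans (Finset.mem_Ico.1 hl).1
  refine (Finset.sum_le_card_nsmul _ _ (((l : ℝ) ^ m * probProd p m) ^ (l - 1)) fun U hU => ?_).trans
    (le_of_eq ?_)
  · obtain ⟨-, hU⟩ := Finset.mem_powersetCard.1 hU
    have := real_allConnected_le (p := p) hm (U := U) (Finset.card_pos.1 (by omega))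
    rwa [hU] at this
  · rw [Finset.card_powersetCard, Finset.card_univ, Fintype.card_fin, nsmul_eq_mul]

/-- Quantitative form of the subcritical statement, for the product of at least two
probabilities. -/
theorem real_percolates_le_of_probProd_le {m : ℕ} (hm2 : 2 ≤ m) (hm : m ≤ r) (hn : 8 ≤ Real.log n)
    (hP : probProd p m ≤ 1 / (jigsawConst r * n * Real.log n ^ (m - 1))) :
    (rFoldBinomial n p).real {G | G.Percolates} ≤ 17 * Real.exp (-(Real.log n / 8)) := by
  set L := Real.log n with hLdef
  have hn0 : 0 < (n : ℝ) := by
    rcases Nat.eq_zero_or_pos n with h0 | h0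
    · rw [hLdef, h0] at hn; norm_num at hn
    · exact_mod_cast h0
  have hnexp : (n : ℝ) = Real.exp L := (Real.exp_log hn0).symm
  have hC := jigsawConst_pos r
  have hLn : L ^ 2 / 2 ≤ n := by
    rw [hnexp]
    have := Real.quadratic_le_exp_of_nonneg (x := L) (by linarith)
    linarith
  set k := ⌈L⌉₊ + 1 with hk
  have hk1 : L + 1 ≤ k := by rw [hk]; push_cast; linarith [Nat.le_ceil L]
  have hk2 : (k : ℝ) ≤ L + 2 := by
    rw [hk]; push_cast; linarith [(Nat.ceil_lt_add_one (show 0 ≤ L by linarith)).le]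
  have hkn : k ≤ n := by
    have : (k : ℝ) ≤ n := by nlinarith
    exact_mod_cast this
  have hP0 : 0 ≤ probProd p m := Finset.prod_nonneg fun i _ => (p i).2.1
  have hterm : ∀ l ∈ Finset.Ico k (2 * k),
      (n.choose l : ℝ) * ((l : ℝ) ^ m * probProd p m) ^ (l - 1) ≤ 4 / n ^ 2 := by
    intro l hl
    rw [Finset.mem_Ico] at hl
    have hlk : (k : ℝ) ≤ l := by exact_mod_cast hl.1
    have hl3 : (l : ℝ) ≤ 3 * L := by
      have : (l : ℝ) + 1 ≤ 2 * k := by exact_mod_cast hl.2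
      linarith
    obtain ⟨q, rfl⟩ : ∃ q, l = q + 1 := ⟨l - 1, by omega⟩
    obtain ⟨t, rfl⟩ : ∃ t, m = t + 1 := ⟨m - 1, by omega⟩
    rw [Nat.add_sub_cancel] at hP ⊢
    set x : ℝ := ((q + 1 : ℕ) : ℝ) with hx
    have hx1 : 1 ≤ x := by rw [hx]; push_cast; linarith [Nat.cast_nonneg (α := ℝ) q]
    have h1 : (n.choose (q + 1) : ℝ) * x ^ (q + 1) ≤ n ^ (q + 1) * Real.exp x := by
      have a1 : (n.choose (q + 1) : ℝ) ≤ (n : ℝ) ^ (q + 1) / (q + 1).factorial :=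
        Nat.choose_le_pow_div _ _
      have a2 : x ^ (q + 1) / (q + 1).factorial ≤ Real.exp x :=
        Real.pow_div_factorial_le_exp x (by linarith) _
      calc (n.choose (q + 1) : ℝ) * x ^ (q + 1) ≤ (n : ℝ) ^ (q + 1) / (q + 1).factorial * x ^ (q + 1) := by
            gcongr
        _ = n ^ (q + 1) * (x ^ (q + 1) / (q + 1).factorial) := by ring
        _ ≤ _ := by gcongr
    have he : Real.exp 1 ≤ 4 := by linarith [Real.exp_one_lt_d9]
    have h2 : Real.exp 1 * (n * x ^ t * probProd p (t + 1)) ≤ Real.exp (-3) := by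
      have b1 : n * x ^ t * probProd p (t + 1) ≤ 3 ^ t / jigsawConst r := by
        calc n * x ^ t * probProd p (t + 1) ≤ n * (3 * L) ^ t * (1 / (jigsawConst r * n * L ^ t)) := by
              gcongr
          _ = _ := by rw [mul_pow]; field_simp
      have b2 : (3 : ℝ) ^ t * Real.exp 4 ≤ jigsawConst r := by
        calc (3 : ℝ) ^ t * Real.exp 4 ≤ 4 ^ r * 4 ^ 4 := by
              gcongr ?_ * ?_
              · calc (3 : ℝ) ^ t ≤ 4 ^ t := by gcongr; norm_num
                  _ ≤ 4 ^ r := pow_le_pow_right₀ (by norm_num) (by omega)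
              · calc Real.exp 4 = Real.exp 1 ^ 4 := by rw [← Real.exp_nat_mul]; norm_num
                  _ ≤ _ := by gcongr
          _ = 2 ^ (2 * r + 8) := by rw [pow_add, pow_mul]; norm_num
          _ ≤ _ := two_pow_le_jigsawConst (by nlinarith)
      have b3 : (3 : ℝ) ^ t / jigsawConst r ≤ Real.exp (-4) := by
        rw [div_le_iff₀ hC, Real.exp_neg, inv_mul_eq_div, le_div_iff₀ (Real.exp_pos _)]
        exact b2
      calc _ ≤ Real.exp 1 * Real.exp (-4) := by gcongr; exact b1.trans b3
        _ = _ := by rw [← Real.exp_add]; norm_num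
    calc (n.choose (q + 1) : ℝ) * (x ^ (t + 1) * probProd p (t + 1)) ^ q
        ≤ (n.choose (q + 1) : ℝ) * (x * (x ^ (t + 1) * probProd p (t + 1)) ^ q) := by
          gcongr
          exact le_mul_of_one_le_left (by positivity) hx1
      _ = ((n.choose (q + 1) : ℝ) * x ^ (q + 1)) * (x ^ t * probProd p (t + 1)) ^ q := by
          rw [pow_succ x t, mul_pow, mul_pow, mul_pow]; ring
      _ ≤ (n ^ (q + 1) * Real.exp x) * (x ^ t * probProd p (t + 1)) ^ q := by gcongr
      _ = n * Real.exp 1 * (Real.exp 1 * (n * x ^ t * probProd p (t + 1))) ^ q := by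
          have : Real.exp x = Real.exp 1 * Real.exp 1 ^ q := by
            rw [← pow_succ', ← Real.exp_nat_mul, mul_one]
          rw [this, mul_assoc (n : ℝ) (x ^ t), mul_pow (Real.exp 1), mul_pow (n : ℝ)]; ring
      _ ≤ n * 4 * Real.exp (-3) ^ q := by gcongr
      _ ≤ n * 4 * Real.exp (-(3 * L)) := by
          rw [← Real.exp_nat_mul]
          gcongr
          have : L + 1 ≤ (q : ℝ) + 1 := by rw [hx] at hlk; push_cast at hlk; linarith
          linarith
      _ = 4 / n ^ 2 := by
          have : Real.exp (-(3 * L)) = 1 / (n : ℝ) ^ 3 := by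
            rw [Real.exp_neg, hnexp, ← Real.exp_nat_mul, one_div]; norm_num
          rw [this]; field_simp
  refine (real_percolates_le_sum hm (by omega) hkn).trans ((Finset.sum_le_card_nsmul _ _ _ hterm).trans ?_)
  rw [Nat.card_Ico, nsmul_eq_mul, show 2 * k - k = k by omega]
  calc (k : ℝ) * (4 / n ^ 2) ≤ n * (4 / n ^ 2) := by
        gcongr
    _ = 4 * Real.exp (-L) := by rw [Real.exp_neg, ← hnexp]; field_simp
    _ ≤ 17 * Real.exp (-(L / 8)) := by
        gcongr
        · norm_num
        · linarith

lemma exists_adj_of_preconnected {V : Type*} {G : SimpleGraph V} (h : G.Preconnected) {v w : V}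
    (hvw : v ≠ w) : ∃ u, G.Adj v u := by
  obtain ⟨q⟩ := h v w
  cases q with
  | nil => exact absurd rfl hvw
  | cons hadj _ => exact ⟨_, hadj⟩

/-- Quantitative form of the subcritical statement, for the smallest probability. -/
theorem real_percolates_le_of_le_log {i : Fin r} (hn : 8 ≤ Real.log n)
    (hp : (p i : ℝ) ≤ Real.log n / (16 * n)) :
    (rFoldBinomial n p).real {G | G.Percolates} ≤ 17 * Real.exp (-(Real.log n / 8)) := by
  classical
  set L := Real.log n with hLdef
  have hn0 : 0 < (n : ℝ) := by
    rcases Nat.eq_zero_or_pos n with h0 | h0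
    · rw [hLdef, h0] at hn; norm_num at hn
    · exact_mod_cast h0
  have hnexp : (n : ℝ) = Real.exp L := (Real.exp_log hn0).symm
  have hp0 := (p i).2.1
  set E := Real.exp (L / 4) with hE
  have hE4 : E ^ 4 = n := by rw [hE, hnexp, ← Real.exp_nat_mul]; congr 1; push_cast; ring
  have hEL : L / 4 + 1 ≤ E := Real.add_one_le_exp _
  set s := ⌈E⌉₊ with hs
  have hs1 : E ≤ s := Nat.le_ceil _
  have hs2 : (s : ℝ) ≤ 2 * E := by
    have := (Nat.ceil_lt_add_one (show 0 ≤ E by linarith)).le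
    linarith
  have hsn : s < n := by
    have h1 : (1 : ℝ) ≤ E := by linarith
    have : (s : ℝ) < n := by
      rw [← hE4]
      calc (s : ℝ) ≤ 2 * E := hs2
        _ < 3 * E := by linarith
        _ ≤ E * E := by gcongr; linarith
        _ = E ^ 2 := by ring
        _ ≤ E ^ 4 := pow_le_pow_right₀ h1 (by norm_num)
    exact_mod_cast this
  have : NeZero n := ⟨by omega⟩
  obtain ⟨S, -, hS⟩ := Finset.exists_subset_card_eq (s := (Finset.univ : Finset (Fin n))) (n := s)
    (by simpa using hsn.le)
  have hSc : (Sᶜ).card = n - s := by rw [Finset.card_compl, hS, Fintype.card_fin]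
  have hsub : {G : RFoldGraph r (Fin n) | G.Percolates} ⊆
      (⋃ e ∈ S.offDiag, {G : RFoldGraph r (Fin n) | (G i).Adj e.1 e.2}) ∪
      {G | ∀ v ∈ S, G ∈ {G : RFoldGraph r (Fin n) | ∃ u ∈ Sᶜ, (G i).Adj u v}} := by
    intro G hG
    by_contra hc
    simp only [Set.mem_union, not_or, Set.mem_ofPred_eq, not_forall] at hc
    obtain ⟨h1, v, hv, h2⟩ := hc
    obtain ⟨w, hw⟩ : (Sᶜ).Nonempty := Finset.card_pos.1 (by omega)
    obtain ⟨u, hu⟩ := exists_adj_of_preconnected (Percolates.preconnected hG i) (v := v) (w := w)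
      (fun h => Finset.mem_compl.1 hw (h ▸ hv))
    by_cases huS : u ∈ S
    · exact h1 (Set.mem_biUnion (x := (v, u)) (Finset.mem_coe.2
        (Finset.mem_offDiag.2 ⟨hv, huS, hu.ne⟩)) hu)
    · exact h2 ⟨u, Finset.mem_compl.2 huS, hu.symm⟩
  have hin : (rFoldBinomial n p).real
      (⋃ e ∈ S.offDiag, {G : RFoldGraph r (Fin n) | (G i).Adj e.1 e.2}) ≤ 16 * Real.exp (-(L / 8)) := by
    refine (measureReal_biUnion_finset_le _ _).trans ?_
    rw [Finset.sum_congr rfl fun e he => real_adj i (Finset.mem_offDiag.1 he).2.2, Finset.sum_const,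
      nsmul_eq_mul]
    have h1 : (S.offDiag.card : ℝ) ≤ s * s := by
      rw [Finset.offDiag_card, hS]
      exact_mod_cast Nat.sub_le _ _
    calc (S.offDiag.card : ℝ) * p i ≤ (2 * E) * (2 * E) * (L / (16 * n)) := by
          gcongr
          exact h1.trans (by gcongr)
      _ ≤ (2 * E) * (2 * E) * ((4 * E) / (16 * E ^ 4)) := by
          rw [hE4]; gcongr; linarith
      _ = E⁻¹ := by field_simp; norm_num
      _ = Real.exp (-(L / 4)) := by rw [hE, Real.exp_neg]
      _ ≤ 1 * Real.exp (-(L / 8)) := by rw [one_mul]; gcongr; linarith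
      _ ≤ _ := by gcongr; norm_num
  have hout : (rFoldBinomial n p).real
      {G | ∀ v ∈ S, G ∈ {G : RFoldGraph r (Fin n) | ∃ u ∈ Sᶜ, (G i).Adj u v}} ≤
        Real.exp (-(L / 8)) := by
    rw [real_biInter_of_dependsOnEdges _ (fun v _ => dependsOnEdges_exists_adj i Sᶜ v)]
    · rw [Finset.prod_congr rfl fun v hv => real_exists_adj i (by simpa using hv), Finset.prod_const,
        hS, hSc]
      have hpn : (p i : ℝ) * n ≤ L / 16 := by
        rw [show L / 16 = L / (16 * n) * n by field_simp]
        gcongr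
      have hp2 : (p i : ℝ) ≤ 1 / 2 := by
        have h2 : L ≤ n := (Real.log_le_sub_one_of_pos hn0).trans (by linarith)
        refine hp.trans ?_
        rw [div_le_iff₀ (by positivity)]; linarith
      have h1 : Real.exp (-(L / 8)) ≤ (1 - (p i : ℝ)) ^ (n - s) := by
        have h2 : Real.exp (-(2 * p i)) ≤ 1 - (p i : ℝ) := by
          have h3 := Real.add_one_le_exp (2 * (p i : ℝ))
          rw [Real.exp_neg, inv_eq_one_div, div_le_iff₀ (Real.exp_pos _)]
          nlinarith
        calc Real.exp (-(L / 8)) ≤ Real.exp (-(2 * p i)) ^ n := by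
              rw [← Real.exp_nat_mul]
              gcongr
              linarith
          _ ≤ (1 - (p i : ℝ)) ^ n := by gcongr
          _ ≤ (1 - (p i : ℝ)) ^ (n - s) :=
              pow_le_pow_of_le_one (by linarith) (by linarith) (Nat.sub_le _ _)
      have h5 : (1 - (p i : ℝ)) ^ (n - s) ≤ 1 := pow_le_one₀ (by linarith) (by linarith)
      refine (one_sub_pow_le_exp h5 s).trans (Real.exp_le_exp.2 (neg_le_neg ?_))
      calc L / 8 ≤ Real.exp (L / 8) := by linarith [Real.add_one_le_exp (L / 8)]
        _ = E * Real.exp (-(L / 8)) := by rw [hE, ← Real.exp_add]; congr 1; ring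
        _ ≤ _ := by gcongr
    · intro v hv w hw hvw
      refine Set.disjoint_left.2 ?_
      rintro x ⟨-, a, ha, hx⟩ ⟨-, b, hb, hx'⟩
      rw [hx, Sym2.eq_iff] at hx'
      rcases hx' with ⟨-, h1⟩ | ⟨h1, -⟩
      · exact hvw h1
      · exact Finset.mem_compl.1 ha (h1 ▸ hw)
  calc _ ≤ _ := measureReal_mono hsub (measure_ne_top _ _)
    _ ≤ _ := measureReal_union_le _ _
    _ ≤ 16 * Real.exp (-(L / 8)) + Real.exp (-(L / 8)) := add_le_add hin hout
    _ = _ := by ring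

end RFoldGraph

namespace RFoldGraph

lemma tendsto_rFoldBinomial_one {r : ℕ → ℕ} {p : (n : ℕ) → Fin (r n) → I}
    {E : (n : ℕ) → Set (RFoldGraph (r n) (Fin n))} {ε : ℕ → ℝ} (hε : Tendsto ε atTop (𝓝 0))
    (h : ∀ᶠ n : ℕ in atTop, (rFoldBinomial n (p n)).real (E n)ᶜ ≤ ε n) :
    Tendsto (fun n : ℕ => rFoldBinomial n (p n) (E n)) atTop (𝓝 1) := by
  have h1 : Tendsto (fun n : ℕ => (rFoldBinomial n (p n)).real (E n)ᶜ) atTop (𝓝 0) :=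
    tendsto_of_tendsto_of_tendsto_of_le_of_le' tendsto_const_nhds hε
      (Eventually.of_forall fun _ => measureReal_nonneg) h
  have h2 : Tendsto (fun n : ℕ => ENNReal.ofReal (1 - (rFoldBinomial n (p n)).real (E n)ᶜ))
      atTop (𝓝 (ENNReal.ofReal (1 - 0))) :=
    ENNReal.tendsto_ofReal (tendsto_const_nhds.sub h1)
  simp only [sub_zero, ENNReal.ofReal_one] at h2
  refine h2.congr fun n => ?_
  rw [real_compl, sub_sub_cancel, ofReal_measureReal]

lemma tendsto_log_natCast : Tendsto (fun n : ℕ => Real.log n) atTop atTop :=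
  Real.tendsto_log_atTop.comp tendsto_natCast_atTop_atTop

lemma eventually_jigsawConst_le {r : ℕ → ℕ}
    (hro : (fun n : ℕ => (r n : ℝ)) =o[atTop] fun n : ℕ => √(Real.log (Real.log n))) :
    ∀ᶠ n : ℕ in atTop, jigsawConst (r n) ≤ Real.log n := by
  have h1 := hro.bound (show (0 : ℝ) < 1 / 4 by norm_num)
  have h2 := (Real.tendsto_log_atTop.comp tendsto_log_natCast).eventually_ge_atTop 0
  filter_upwards [h1, h2, tendsto_log_natCast.eventually_gt_atTop 0] with n hn hn2 hn0
  simp only [Function.comp_apply] at hn2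
  rw [Real.norm_of_nonneg (Nat.cast_nonneg _), Real.norm_of_nonneg (Real.sqrt_nonneg _)] at hn
  rw [← Real.exp_log hn0]
  have h3 : (r n : ℝ) ^ 2 ≤ Real.log (Real.log n) / 16 := by
    calc (r n : ℝ) ^ 2 ≤ (1 / 4 * √(Real.log (Real.log n))) ^ 2 := by gcongr
      _ = _ := by rw [mul_pow, Real.sq_sqrt hn2]; ring
  have h4 : (2 : ℝ) ≤ Real.exp 1 := by linarith [Real.add_one_le_exp 1]
  calc jigsawConst (r n) ≤ Real.exp 1 ^ (8 * r n ^ 2) := by unfold jigsawConst; gcongr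
    _ = Real.exp (8 * (r n : ℝ) ^ 2) := by
        rw [← Real.exp_nat_mul]; push_cast; ring_nf
    _ ≤ _ := Real.exp_le_exp.2 (by linarith)

end RFoldGraph

theorem theorem2 (r : ℕ → ℕ) (hr : ∀ n, 2 ≤ r n)
    (hro : (fun n : ℕ => (r n : ℝ)) =o[atTop] fun n : ℕ => √(Real.log (Real.log n)))
    (p : (n : ℕ) → Fin (r n) → I) (hp : ∀ n, Monotone (p n)) :
    ((∀ᶠ n : ℕ in atTop,
        (∃ i : ℕ, 2 ≤ i ∧ i ≤ r n ∧
          probProd (p n) i ≤ 1 / (jigsawConst (r n) * n * Real.log n ^ (i - 1))) ∨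
        probProd (p n) 1 ≤ Real.log n / (jigsawConst (r n) * n)) →
      Tendsto (fun n : ℕ => rFoldBinomial n (p n) {G | ¬ G.Percolates}) atTop (𝓝 1)) ∧
    ((∀ᶠ n : ℕ in atTop,
        (∀ i : ℕ, 2 ≤ i → i ≤ r n →
          jigsawConst (r n) / (n * Real.log n ^ (i - 1)) ≤ probProd (p n) i) ∧
        jigsawConst (r n) * Real.log n / n ≤ probProd (p n) 1) →
      Tendsto (fun n : ℕ => rFoldBinomial n (p n) {G | G.Percolates}) atTop (𝓝 1)) := by
  refine ⟨fun h => ?_, fun h => ?_⟩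
  · refine RFoldGraph.tendsto_rFoldBinomial_one
      (ε := fun n : ℕ => 17 * Real.exp (-(Real.log n / 8))) ?_ ?_
    · have h1 : Tendsto (fun n : ℕ => Real.exp (-(Real.log n / 8))) atTop (𝓝 0) :=
        Real.tendsto_exp_neg_atTop_nhds_zero.comp
          (RFoldGraph.tendsto_log_natCast.atTop_div_const (by norm_num))
      simpa using h1.const_mul 17
    · filter_upwards [h, RFoldGraph.tendsto_log_natCast.eventually_ge_atTop 8,
        eventually_gt_atTop 0] with n hn hL hn0
      have hcompl : {G : RFoldGraph (r n) (Fin n) | ¬ G.Percolates}ᶜ = {G | G.Percolates} := by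
        ext G; simp
      rw [hcompl]
      rcases hn with ⟨i, hi2, hir, hP⟩ | hP
      · exact RFoldGraph.real_percolates_le_of_probProd_le hi2 hir hL hP
      · have hr2 := hr n
        have hset : Finset.univ.filter (fun j : Fin (r n) => j.val < 1) = {⟨0, by omega⟩} := by
          ext j; simp [Fin.ext_iff]
        rw [probProd, hset, Finset.prod_singleton] at hP
        refine RFoldGraph.real_percolates_le_of_le_log hL (hP.trans ?_)
        have h16 : (16 : ℝ) ≤ jigsawConst (r n) :=
          le_trans (by norm_num)
            (RFoldGraph.two_pow_le_jigsawConst (r := r n) (k := 4) (by nlinarith))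
        have hn0' : (0 : ℝ) < n := by exact_mod_cast hn0
        gcongr
  · refine RFoldGraph.tendsto_rFoldBinomial_one (ε := fun n : ℕ => 9 / √(Real.log n)) ?_ ?_
    · exact tendsto_const_nhds.div_atTop
        (Real.tendsto_sqrt_atTop.comp RFoldGraph.tendsto_log_natCast)
    · filter_upwards [h, RFoldGraph.eventually_jigsawConst_le hro] with n hn hC
      exact RFoldGraph.Supercritical.real_not_percolates_le
        ⟨hr n, hp n, hC, hn.2, hn.1⟩
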